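/- **Setting.** Let $n\ge 1$, $m\in\{0,\dots,n+1\}$, $\hbar>0$, $\bar b\in\mathbb R$. Let $\Omega\subset\mathbb R^n$ be the open set of $\lambda=(\lambda_1,\dots,\lambda_n)$ with pairwise distinct entries, all nonzero if $m\ge 1$, and let $T\subset\mathbb R^n$ be an open set of multi-times $t=(t_1,\dots,t_n)$. Put $\rho_i=(-1)^i s_i(\lambda)$ ($s_i$ the elementary symmetric polynomials; $\rho_0=1$, $\rho_i=0$ for $i<0$ or $i>n$), $\Delta_j=\prod_{k\ne j}(\lambda_j-\lambda_k)$, $G^{ij}=\frac{\lambda_i^m}{\Delta_i}\delta^{ij}$, $g=G^{-1}$, $|g|=|\det g|$, and $$A_r^{ij}=-\frac{\partial\rho_r}{\partial\lambda_i}\frac{\lambda_i^m}{\Delta_i}\delta^{ij},\quad (P_r^{(\gamma)})^j=\frac{\partial\rho_r}{\partial\lambda_j}\frac{\lambda_j^\gamma}{\Delta_j},\quad V_r^{(\alpha)}=\sum_{j=1}^n\frac{\partial\rho_r}{\partial\lambda_j}\frac{\lambda_j^\alpha}{\Delta_j},\qquad r=1,\dots,n .$$ Let $I_1^m=\{r: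 2\le r\le n,\ r\le n-m+1\}$ and $I_2^m=\{r:2\le r\le n,\ r\ge n-m+2\}$. In the coordinates $q_i=\rho_i(\lambda)$ let $J_1=0$ and $$J_r=\sum_{k=n+2-m-r}^{n-m}(n+1-m-k)\,q_{m+r-n-2+k}\,\frac{\partial}{\partial q_k}\ (r\in I_1^m),\qquad J_r=-\sum_{k=n+2-m}^{2n+2-m-r}(n+1-m-k)\,q_{m+r-n-2+k}\,\frac{\partial}{\partial q_k}\ (r\in I_2^m),$$ where $\frac{\partial}{\partial q_k}=-\sum_j\frac{\lambda_j^{n-k}}{\Delta_j}\frac{\partial}{\partial\lambda_j}$. The minimal quantizations of $\tfrac12 C^{kj}\mu_k\mu_j$ and of $X^j\mu_j$ are the operators $$-\tfrac12\hbar^2\sum_{k,j}|g|^{-1/2}\partial_k|g|^{1/2}C^{kj}\partial_j,\qquad -\tfrac12 i\hbar\sum_j\left(|g|^{-1/2}\partial_j|g|^{1/2}X^j+X^j\partial_j\right).$$ Let $\widehat E_r,\widehat W_r,\widehat M_r^{(\gamma)}$ be the minimal quantizations given by $C=A_r$, $X=J_r$, $X=P_r^{(\gamma)}$. All operators act on smooth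 functions $\psi:\Omega\to\mathbb C$. For smooth real functions $d_0,\dots,d_{n+1}$, $e_0,\dots,e_{n-1}$, $\zeta_{r,j}$ on $T$, and $e_n=1$ if $m\le n$, $e_n=e^{t_1}$ if $m=n+1$, put $$\widehat h_r^A=\widehat E_r+\widehat W_r+\sum_{\alpha=-m}^{2n-m+2}c_\alpha(t)V_r^{(\alpha)},\qquad \widehat h_r^B=\widehat E_r+\widehat W_r+\sum_{\gamma=0}^{n+1}d_\gamma(t)\widehat M_r^{(\gamma)}+\bar b\,e_n(t)V_r^{(n)}-\bar b\,e_{n-r}(t).$$ For $X\in\{A,B\}$ let $\widehat H_r^X=\sum_{j=1}^n\widetilde\zeta_{r,j}(t)\,\widehat h_j^X$, where $\widetilde\zeta_{r,r}=1$, $\widetilde\zeta_{r,j}=\zeta_{r,j}(t)$ if either $r\in\{1\}\cup I_1^m$, $r>\lfloor\frac{n+3-m}2\rfloor$, $j<r$, or $r\in I_2^m$, $r\le n-\lfloor\frac m2\rfloor$, $j>r$, and $\widetilde\zeta_{r,j}=0$ for all other $j\ne r$. **Hypothesis (linear first-order PDEs).** On $T$, for all $r=1,\dots,n$ and $\gamma=0,\dots,n+1$,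 with $d_k:=0$ for $k\notin\{0,\dots,n+1\}$: * if $r\in\{1\}\cup I_1^m$: $\ \partial_{t_r}d_\gamma=(\gamma-m+1)\sum_{j}\widetilde\zeta_{r,j}\,d_{\gamma+n+2-m-j}$ for $\gamma\ge m$, and $\partial_{t_r}d_\gamma=0$ for $\gamma\le m-1$; * if $r\in I_2^m$: $\ \partial_{t_r}d_\gamma=-(\gamma-m+1)\sum_{j}\widetilde\zeta_{r,j}\,d_{\gamma+n+2-m-j}$ for $\gamma\le m-2$, and $\partial_{t_r}d_\gamma=0$ for $\gamma\ge m-1$. **Theorem.** Let $U=U(\lambda,t)=e^{F(\lambda,t)}$ with $$F(\lambda,t)=-\frac i\hbar\sum_{\gamma=0}^{n+1}\frac{d_\gamma(t)}{\gamma-m+1}\sum_{j=1}^n\lambda_j^{\gamma-m+1},$$ where for $\gamma=m-1$ the expression $\lambda_j^{\gamma-m+1}/(\gamma-m+1)$ is read as $\log|\lambda_j|$. Then, for all $t\in T$ and $r=1,\dots,n$, $$\widehat H_r^A=U\,\widehat H_r^B\,U^\dagger-i\hbar\,U\,\frac{\partial U^\dagger}{\partial t_r},$$ where $\widehat H^A_r$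 is taken with the coefficients $$c_\alpha=\tfrac12\sum_{\gamma+\gamma'-m=\alpha}d_\gamma d_{\gamma'}+\delta_{\alpha,n}\left(\bar b\,e_n-d_{n+1}\right)+\epsilon_\alpha ,\qquad -m\le\alpha\le 2n-m+2$$ ($0\le\gamma,\gamma'\le n+1$ in the sum). Here $\epsilon_\alpha=0$ unless $0\le\alpha\le n-1$, in which case, with $r=n-\alpha$, $\epsilon_\alpha=\bar b\,e_\alpha+(n-\alpha-1)d_{\alpha+1}$ if $r\in\{1\}\cup I_1^m$ and $\epsilon_\alpha=\bar b\,e_\alpha-(\alpha+1)d_{\alpha+1}$ if $r\in I_2^m$. Moreover, the operators $\widehat H_r^B$ satisfy the quantum Frobenius condition $i\hbar\,\partial_{t_s}\widehat H_r-i\hbar\,\partial_{t_r}\widehat H_s+[\widehat H_r,\widehat H_s]=0$ ($r,s=1,\dots,n$) on $T$ if and only if the operators $\widehat H_r^A$ do. -/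

import Mathlib

open scoped ContDiff

noncomputable section

namespace QPainleve

/-- Points of `ℝⁿ`, used for the separation coordinates `λ` and for the multi-time `t`.
The paper-style indices `1, …, n` are the values `idx r` for `r : Fin n`. -/
abbrev Pt (n : ℕ) := Fin n → ℝ

/-- Linear operators (here: differential operators) act on complex functions of `λ`. -/
abbrev Op (n : ℕ) := (Pt n → ℂ) → Pt n → ℂ

/-- The one-based index. -/
def idx {n : ℕ} (r : Fin n) : ℤ := (r : ℤ) + 1

/-- The partial derivative `∂f/∂x_j`. -/
def pd {n : ℕ} {E : Type*} [NormedAddCommGroup E] [NormedSpace ℝ E]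
    (j : Fin n) (f : Pt n → E) (x : Pt n) : E :=
  fderiv ℝ f x (Pi.single j 1)

/-! ### Geometry in the separation coordinates -/

/-- The domain of the separation coordinates: pairwise distinct, and nonzero
(unless `m = 0`, where the metric is regular at `λ_j = 0`). -/
def configSpace (n m : ℕ) : Set (Pt n) :=
  {x | Function.Injective x ∧ (m ≠ 0 → ∀ j, x j ≠ 0)}

/-- The Viète coordinates `q_i = ρ_i(λ) = (-1)^i s_i(λ)`, with `q_0 = 1` and
`q_i = 0` for `i < 0` and for `i > n`. -/
def rho {n : ℕ} (i : ℤ) (x : Pt n) : ℝ :=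
  if i < 0 then 0
  else (-1) ^ i.toNat *
    ∑ s ∈ Finset.powersetCard i.toNat (Finset.univ : Finset (Fin n)), ∏ j ∈ s, x j

/-- `Δ_j = ∏_{k ≠ j} (λ_j - λ_k)`. -/
def Delta {n : ℕ} (j : Fin n) (x : Pt n) : ℝ :=
  ∏ k ∈ Finset.univ.erase j, (x j - x k)

/-- The contravariant metric `G^{ij} = λ_i^m / Δ_i δ^{ij}`. -/
def metricG {n : ℕ} (m : ℕ) (x : Pt n) : Matrix (Fin n) (Fin n) ℝ :=
  Matrix.diagonal fun i => x i ^ m / Delta i x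

/-- The density `|g|^{1/2}`, where `g = G⁻¹` is the covariant metric. -/
def vol {n : ℕ} (m : ℕ) (x : Pt n) : ℝ :=
  Real.sqrt |((metricG m x)⁻¹).det|

/-- The tensors `A_r^{ij} = -(∂ρ_r/∂λ_i) λ_i^m / Δ_i δ^{ij}`. -/
def tensorA {n : ℕ} (m : ℕ) (r : Fin n) (x : Pt n) : Matrix (Fin n) (Fin n) ℝ :=
  Matrix.diagonal fun i => -(pd i (rho (idx r)) x) * (x i ^ m / Delta i x)

/-- The basic separable vector potentials `(P_r^{(γ)})^j = (∂ρ_r/∂λ_j) λ_j^γ / Δ_j`. -/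
def vecP {n : ℕ} (γ : ℤ) (r : Fin n) (x : Pt n) (j : Fin n) : ℝ :=
  pd j (rho (idx r)) x * (x j ^ γ / Delta j x)

/-- The basic separable scalar potentials `V_r^{(α)} = ∑_j (∂ρ_r/∂λ_j) λ_j^α / Δ_j`. -/
def potV {n : ℕ} (α : ℤ) (r : Fin n) (x : Pt n) : ℝ :=
  ∑ j, pd j (rho (idx r)) x * (x j ^ α / Delta j x)

/-- The components of the Killing field `J_r` in the Viète coordinates (as functions of `λ`);
the two cases are `r ∈ I_1^m` and `r ∈ I_2^m`, and `J_1 = 0`. -/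
def killingQ {n : ℕ} (m : ℕ) (r k : ℤ) (x : Pt n) : ℝ :=
  if 2 ≤ r ∧ r ≤ (n : ℤ) - m + 1 then
    if (n : ℤ) + 2 - m - r ≤ k ∧ k ≤ (n : ℤ) - m then
      (((n : ℤ) + 1 - m - k : ℤ) : ℝ) * rho ((m : ℤ) + r - n - 2 + k) x
    else 0
  else if 2 ≤ r ∧ (n : ℤ) - m + 2 ≤ r ∧ r ≤ n then
    if (n : ℤ) + 2 - m ≤ k ∧ k ≤ 2 * (n : ℤ) + 2 - m - r then
      -((((n : ℤ) + 1 - m - k : ℤ) : ℝ) * rho ((m : ℤ) + r - n - 2 + k) x)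
    else 0
  else 0

/-- The components of `J_r` in the separation coordinates. They are read off from
`W_r = ∑_k J_r^k p_k = ∑_j J_r^{λ_j} μ_j` with
`p_k = -∑_j λ_j^{n-k} / Δ_j μ_j`, i.e. `∂λ_j/∂q_k = -λ_j^{n-k}/Δ_j`. -/
def killingJ {n : ℕ} (m : ℕ) (r : Fin n) (x : Pt n) (j : Fin n) : ℝ :=
  -∑ k : Fin n, killingQ m (idx r) (idx k) x * (x j ^ ((n : ℤ) - idx k) / Delta j x)

/-! ### Minimal quantization -/

/-- Minimal quantization of `½ C^{kj} μ_k μ_j`: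
`-½ ħ² |g|^{-1/2} ∂_k |g|^{1/2} C^{kj} ∂_j`. -/
def quantQuad {n : ℕ} (hbar : ℝ) (m : ℕ) (C : Pt n → Matrix (Fin n) (Fin n) ℝ) : Op n :=
  fun ψ x => -(1 / 2 : ℂ) * (hbar : ℂ) ^ 2 * ((vol m x : ℝ) : ℂ)⁻¹ *
    ∑ k, pd k (fun y => ((vol m y : ℝ) : ℂ) * ∑ j, ((C y k j : ℝ) : ℂ) * pd j ψ y) x

/-- Minimal quantization of `X^j μ_j`:
`-½ i ħ (|g|^{-1/2} ∂_j |g|^{1/2} X^j + X^j ∂_j)`. -/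
def quantLin {n : ℕ} (hbar : ℝ) (m : ℕ) (X : Pt n → Fin n → ℝ) : Op n :=
  fun ψ x => -(1 / 2 : ℂ) * Complex.I * (hbar : ℂ) *
    ((((vol m x : ℝ) : ℂ)⁻¹ *
        ∑ j, pd j (fun y => ((vol m y : ℝ) : ℂ) * ((X y j : ℝ) : ℂ) * ψ y) x) +
      ∑ j, ((X x j : ℝ) : ℂ) * pd j ψ x)

/-- `Ê_r + Ŵ_r`, the quantized geodesic quasi-Stäckel Hamiltonian. -/
def geodesicOp {n : ℕ} (hbar : ℝ) (m : ℕ) (r : Fin n) : Op n := fun ψ x =>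
  quantQuad hbar m (tensorA m r) ψ x + quantLin hbar m (killingJ m r) ψ x

/-! ### The operators `ĥ_r^A`, `ĥ_r^B` -/

/-- `ĥ_r^A = Ê_r + Ŵ_r + ∑_{α=-m}^{2n-m+2} c_α(t) V_r^{(α)}`. -/
def hA {n : ℕ} (hbar : ℝ) (m : ℕ) (c : ℤ → Pt n → ℝ) (r : Fin n) (t : Pt n) : Op n :=
  fun ψ x => geodesicOp hbar m r ψ x +
    ((∑ α ∈ Finset.Icc (-(m : ℤ)) (2 * n - m + 2), c α t * potV α r x : ℝ) : ℂ) * ψ x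

/-- `e_n(t) = 1` for `m ≤ n` and `e_n(t) = exp(t_1)` for `m = n + 1`. -/
def eTop (n m : ℕ) [NeZero n] (t : Pt n) : ℝ :=
  if m = n + 1 then Real.exp (t 0) else 1

/-- The extended magnetic operator
`ĥ_r^B = Ê_r + Ŵ_r + ∑_{γ=0}^{n+1} d_γ(t) M̂_r^{(γ)} + b̄ e_n(t) V_r^{(n)} - b̄ e_{n-r}(t)`. -/
def hB {n : ℕ} [NeZero n] (hbar : ℝ) (m : ℕ) (d : ℤ → Pt n → ℝ) (bbar : ℝ)
    (e : ℤ → Pt n → ℝ) (r : Fin n) (t : Pt n) : Op n :=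
  fun ψ x => geodesicOp hbar m r ψ x +
    (∑ γ ∈ Finset.Icc (0 : ℤ) (n + 1), ((d γ t : ℝ) : ℂ) * quantLin hbar m (vecP γ r) ψ x) +
    ((bbar * eTop n m t * potV n r x - bbar * e (n - idx r) t : ℝ) : ℂ) * ψ x

/-! ### The deformation from `ĥ_r` to `Ĥ_r` -/

/-- `r ∈ {1} ∪ I_1^m`. -/
def InFirst (n m : ℕ) (r : ℤ) : Prop := r = 1 ∨ r ≤ (n : ℤ) - m + 1

open Classical in
/-- The coefficient of `h_j` in `H_r`. With `κ₁ = ⌊(n+3-m)/2⌋`, `κ₂ = ⌊m/2⌋`: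
for `r ∈ {1} ∪ I_1^m`, `H_r = h_r` if `r ≤ κ₁` and `H_r = h_r + ∑_{j<r} ζ_{r,j} h_j` otherwise;
for `r ∈ I_2^m`, `H_r = h_r + ∑_{j>r} ζ_{r,j} h_j` if `r ≤ n - κ₂` and `H_r = h_r` otherwise. -/
def deformCoeff {n : ℕ} (m : ℕ) (ζ : Fin n → Fin n → Pt n → ℝ) (r j : Fin n) (t : Pt n) : ℝ :=
  if j = r then 1
  else if InFirst n m (idx r) then
    if ((n : ℤ) + 3 - m) / 2 < idx r ∧ j < r then ζ r j t else 0
  else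
    if idx r ≤ (n : ℤ) - (m : ℤ) / 2 ∧ r < j then ζ r j t else 0

/-- The deformed family `H_r = ∑_j ζ_{r,j}(t) h_j`. -/
def deform {n : ℕ} (m : ℕ) (ζ : Fin n → Fin n → Pt n → ℝ) (h : Fin n → Pt n → Op n)
    (r : Fin n) (t : Pt n) : Op n :=
  fun ψ x => ∑ j, ((deformCoeff m ζ r j t : ℝ) : ℂ) * h j t ψ x

/-! ### The PDE system, the map `(d, e) ↦ c` and the transformation -/

/-- `∑_j ζ_{r,j} d_{γ+n+2-m-j}`, with `d_k` read as `0` unless `0 ≤ k ≤ n+1`. -/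
def shiftSum {n : ℕ} (m : ℕ) (ζ : Fin n → Fin n → Pt n → ℝ) (d : ℤ → Pt n → ℝ)
    (r : Fin n) (γ : ℤ) (t : Pt n) : ℝ :=
  ∑ j, deformCoeff m ζ r j t *
    (if 0 ≤ γ + n + 2 - m - idx j ∧ γ + n + 2 - m - idx j ≤ n + 1
      then d (γ + n + 2 - m - idx j) t else 0)

open Classical in
/-- The linear first-order system for `d_γ` (with coefficients `ζ_{r,j}`), on the set `T` of
multi-times. -/
def PDESystem {n : ℕ} (m : ℕ) (ζ : Fin n → Fin n → Pt n → ℝ) (d : ℤ → Pt n → ℝ)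
    (T : Set (Pt n)) : Prop :=
  ∀ t ∈ T, ∀ r : Fin n, ∀ γ ∈ Finset.Icc (0 : ℤ) (n + 1),
    pd r (d γ) t =
      if InFirst n m (idx r) then
        if (m : ℤ) ≤ γ then ((γ - m + 1 : ℤ) : ℝ) * shiftSum m ζ d r γ t else 0
      else
        if γ ≤ (m : ℤ) - 2 then -((γ - m + 1 : ℤ) : ℝ) * shiftSum m ζ d r γ t else 0

open Classical in
/-- The coefficients `c_α(t)` of the non-magnetic system. The last term affects only
`0 ≤ α ≤ n - 1`, where `V_r^{(α)} = -δ_{r,n-α}` is constant. -/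
def cOf {n : ℕ} [NeZero n] (m : ℕ) (d : ℤ → Pt n → ℝ) (bbar : ℝ) (e : ℤ → Pt n → ℝ)
    (α : ℤ) (t : Pt n) : ℝ :=
  (1 / 2) * (∑ γ ∈ Finset.Icc (0 : ℤ) (n + 1), ∑ γ' ∈ Finset.Icc (0 : ℤ) (n + 1),
      if γ + γ' - m = α then d γ t * d γ' t else 0) +
    (if α = n then bbar * eTop n m t - d (n + 1) t else 0) +
    (if 0 ≤ α ∧ α ≤ (n : ℤ) - 1 then
      bbar * e α t +
        (if InFirst n m (n - α) then ((n - α - 1 : ℤ) : ℝ) * d (α + 1) t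
          else -((α + 1 : ℤ) : ℝ) * d (α + 1) t)
      else 0)

/-- The primitive `λ^{k+1}/(k+1)` of `λ^k`, read as `log |λ|` for `k = -1`
(`Real.log` is `log |·|`). -/
def primPow (k : ℤ) (s : ℝ) : ℝ :=
  if k = -1 then Real.log s else s ^ (k + 1) / ((k + 1 : ℤ) : ℝ)

/-- `F(λ,t) = -(i/ħ) ∑_γ d_γ(t)/(γ-m+1) ∑_j λ_j^{γ-m+1}`. -/
def phaseF {n : ℕ} (hbar : ℝ) (m : ℕ) (d : ℤ → Pt n → ℝ) (t x : Pt n) : ℂ :=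
  -(Complex.I / (hbar : ℂ)) *
    ((∑ γ ∈ Finset.Icc (0 : ℤ) (n + 1), d γ t * ∑ j, primPow (γ - m) (x j) : ℝ) : ℂ)

/-- `U(λ,t) = exp F(λ,t)`. -/
def gaugeU {n : ℕ} (hbar : ℝ) (m : ℕ) (d : ℤ → Pt n → ℝ) (t x : Pt n) : ℂ :=
  Complex.exp (phaseF hbar m d t x)

/-- `U†`: the adjoint of multiplication by `U` is multiplication by its complex conjugate. -/
def gaugeUdag {n : ℕ} (hbar : ℝ) (m : ℕ) (d : ℤ → Pt n → ℝ) (t x : Pt n) : ℂ :=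
  (starRingEnd ℂ) (gaugeU hbar m d t x)

/-- The quantum Frobenius condition
`iħ ∂Ĥ_r/∂t_s - iħ ∂Ĥ_s/∂t_r + [Ĥ_r, Ĥ_s] = 0` for multi-times in `T`,
the operators acting on smooth functions on `configSpace n m`. -/
def QuantumFrobenius {n : ℕ} (hbar : ℝ) (m : ℕ) (T : Set (Pt n)) (H : Fin n → Pt n → Op n) :
    Prop :=
  ∀ t ∈ T, ∀ r s : Fin n, ∀ ψ : Pt n → ℂ, ContDiffOn ℝ ∞ ψ (configSpace n m) →
    ∀ x ∈ configSpace n m,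
      Complex.I * (hbar : ℂ) * pd s (fun τ => H r τ ψ x) t -
        Complex.I * (hbar : ℂ) * pd r (fun τ => H s τ ψ x) t +
        (H r t (H s t ψ) x - H s t (H r t ψ) x) = 0

end QPainleve

end

/-! Write `W = phaseSum` for the real phase, so that `U = exp(-iW/ħ)`, and let `∇W` be its
λ-gradient, with components `∑ d_γ λ_j^(γ-m)`. Conjugation by `U` sends `-iħ∂` to `-iħ∂ + ∇W`. Since
`A_r ∇W = -∑ d_γ P_r^(γ)`, conjugating the kinetic term produces exactly the opposite of the
magnetic terms, so these cancel. What remains is a scalar: the quadratic form `½ ∑∑ d_γ d_γ'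
V_r^(γ+γ'-m)`, the pairing of `J_r` with `∇W`, and the terms in `b̄` (`hB_gaugeUdag_mul`). The
time-derivative term of the gauge transformation adds `∂W/∂t_r`.

It therefore has to be shown that the scalar potentials of the A family and of the conjugated B
family, once deformed, differ by `∂W/∂t_r` (`sum_deformCoeff_scalar`). The only non-obvious
ingredient is the pairing of `J_r` with `λ^(γ-m)`. In Viète coordinates it is a weighted partial sum
of `ρ_a L_(k-a)`, where `L_k = ∑ λ_i^k / Δ_i`. Lagrange interpolation gives `L_k = δ_{k,n-1}` for `0
≤ k ≤ n-1`, and differentiating the nodal polynomial shows that the complete weighted sum is a power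
sum. Hence the pairing is a constant, a power sum, or a power sum corrected by `ρ_r`, according to
the exponent. The constants are the `d_(α+1)` terms of `ε_α`, the correction is the `-d_(n+1)` in
`c_n`, and the power sums reproduce the right-hand side of the linear PDE system after integration
in `λ`.

For the Frobenius condition, the A operators are the conjugated B operators plus multiplication by
`∂W/∂t_r`. In the commutator the terms symmetric in `r, s` drop out, the commutators with the phase
cancel against the time derivative of the conjugation, and the mixed derivatives of `W` agree. The
two defects are thus conjugate by `U` (`frobenius_defect`), and `U` vanishes nowhere. -/

noncomputable section

namespace QPainleve

variable {n : ℕ}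

/-! ### Viète coordinates, the nodal polynomial and Lagrange sums -/

lemma rho_natCast (a : ℕ) (x : Pt n) :
    rho (a : ℤ) x = (-1) ^ a * ∑ s ∈ Finset.powersetCard a (Finset.univ : Finset (Fin n)),
      ∏ j ∈ s, x j := by
  simp [rho]

lemma rho_zero (x : Pt n) : rho 0 x = 1 := by
  simp [rho]

open Polynomial in
lemma nodal_univ_eq_sum_rho (x : Pt n) :
    Lagrange.nodal Finset.univ x =
      ∑ a ∈ Finset.range (n + 1), C (rho (a : ℤ) x) * X ^ (n - a) := by
  have h := Multiset.prod_X_sub_X_eq_sum_esymm (Finset.univ.val.map x)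
  rw [Multiset.map_map] at h
  rw [Lagrange.nodal_eq]
  refine Eq.trans ?_ (h.trans ?_)
  · rfl
  · simp only [Multiset.card_map, Finset.card_val, Finset.card_univ, Fintype.card_fin,
      Finset.esymm_map_val]
    refine Finset.sum_congr rfl fun a _ => ?_
    rw [rho_natCast]
    simp only [map_mul, map_pow, map_neg, map_one]
    ring

lemma sum_rho_mul_pow (x : Pt n) (i : Fin n) :
    ∑ a ∈ Finset.range (n + 1), rho (a : ℤ) x * x i ^ (n - a) = 0 := by
  have h := Lagrange.eval_nodal_at_node (v := x) (Finset.mem_univ i)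
  rw [nodal_univ_eq_sum_rho, Polynomial.eval_finsetSum] at h
  simpa using h

/-- The derivative of the nodal polynomial at the node `x i` is `Δ_i`, which is the case `c = n`
after multiplication by `x i`. Changing `c` adds a multiple of the nodal polynomial itself, which
vanishes at its nodes; this freedom later matches the weights of the Killing fields. -/
lemma sum_sub_mul_rho_mul_pow (x : Pt n) (i : Fin n) (c : ℝ) :
    ∑ a ∈ Finset.range (n + 1), (c - a) * rho (a : ℤ) x * x i ^ (n - a) =
      x i * Delta i x := by
  have h := Lagrange.eval_nodal_derivative_eval_node_eq (v := x) (Finset.mem_univ i)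
  rw [nodal_univ_eq_sum_rho, Lagrange.eval_nodal, Polynomial.derivative_sum,
    Polynomial.eval_finsetSum] at h
  have h0 := sum_rho_mul_pow x i
  have : ∑ a ∈ Finset.range (n + 1), (c - a) * rho (a : ℤ) x * x i ^ (n - a) =
      (c - n) * (∑ a ∈ Finset.range (n + 1), rho (a : ℤ) x * x i ^ (n - a)) +
      x i * ∑ a ∈ Finset.range (n + 1), rho (a : ℤ) x * (((n - a : ℕ) : ℝ) * x i ^ (n - a - 1)) := by
    rw [Finset.mul_sum, Finset.mul_sum, ← Finset.sum_add_distrib]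
    refine Finset.sum_congr rfl fun a ha => ?_
    have ha' : a ≤ n := by simpa [Nat.lt_succ_iff] using ha
    rcases Nat.eq_zero_or_pos (n - a) with h1 | h1
    · have : a = n := by omega
      subst this
      simp
    · obtain ⟨q, hq⟩ : ∃ q, n - a = q + 1 := ⟨n - a - 1, by omega⟩
      have hc : (n : ℝ) = a + (q + 1 : ℕ) := by
        exact_mod_cast (by omega : n = a + (q + 1))
      rw [hq, hc]
      push_cast
      ring
  rw [this, h0, mul_zero, zero_add]
  congr 1
  rw [Delta, ← h]
  refine Finset.sum_congr rfl fun a _ => ?_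
  rw [Polynomial.derivative_C_mul_X_pow]
  simp [mul_assoc]

/-- The sum `∑ᵢ xᵢᵏ / Δᵢ`. -/
def lagrangeSum (k : ℤ) (x : Pt n) : ℝ := ∑ i, x i ^ k / Delta i x

lemma Delta_ne_zero {x : Pt n} (hx : Function.Injective x) (i : Fin n) : Delta i x ≠ 0 := by
  refine Finset.prod_ne_zero_iff.2 fun k hk => sub_ne_zero.2 fun h => ?_
  exact (Finset.ne_of_mem_erase hk) (hx h).symm

/-- The sum is the coefficient of `X^(n-1)` in the polynomial of degree less than `n` interpolating
`X^k`, which is `X^k` itself. -/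
lemma lagrangeSum_of_lt {x : Pt n} (hx : Function.Injective x) {k : ℤ} (h0 : 0 ≤ k)
    (hk : k ≤ n - 1) : lagrangeSum k x = if k = n - 1 then 1 else 0 := by
  lift k to ℕ using h0
  have hlt : k < n := by omega
  have h := Lagrange.coeff_eq_sum (s := Finset.univ) (v := x) hx.injOn
    (P := (Polynomial.X ^ k : Polynomial ℝ)) (by
      rw [Polynomial.degree_X_pow]; simpa using hlt)
  simp only [Polynomial.coeff_X_pow, Finset.card_univ, Fintype.card_fin, Polynomial.eval_pow,
    Polynomial.eval_X] at h
  simp only [lagrangeSum, zpow_natCast, Delta]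
  rw [← h]
  have : ((k : ℤ) = n - 1) ↔ (n - 1 = k) := by omega
  simp only [this]

/-- When `m = 0` an entry may be zero, and integer powers of zero are not additive across signs. The
alternative `n ≤ k` keeps all exponents nonnegative. -/
lemma zpow_sub_natCast {y : ℝ} {k : ℤ} (h : y ≠ 0 ∨ (n : ℤ) ≤ k) {a : ℕ} (ha : a ≤ n) :
    y ^ (k - a) = y ^ (k - n) * y ^ (n - a) := by
  have e : k - a = (k - n) + ((n - a : ℕ) : ℤ) := by omega
  rcases h with h | h
  · rw [e, zpow_add₀ h, zpow_natCast]
  · obtain ⟨q, hq⟩ := Int.eq_ofNat_of_zero_le (sub_nonneg.2 h)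
    rw [e, hq, zpow_natCast, ← Nat.cast_add, zpow_natCast, pow_add]

lemma sum_rho_mul_lagrangeSum {x : Pt n} {k : ℤ} (hk : (∀ i, x i ≠ 0) ∨ (n : ℤ) ≤ k) :
    ∑ a ∈ Finset.range (n + 1), rho (a : ℤ) x * lagrangeSum (k - a) x = 0 := by
  simp only [lagrangeSum, Finset.mul_sum]
  rw [Finset.sum_comm]
  refine Finset.sum_eq_zero fun i _ => ?_
  rw [← mul_zero (x i ^ (k - n) / Delta i x), ← sum_rho_mul_pow x i, Finset.mul_sum]
  refine Finset.sum_congr rfl fun a ha => ?_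
  rw [zpow_sub_natCast (hk.imp (fun h => h i) id) (by simpa [Nat.lt_succ_iff] using ha)]
  ring

lemma sum_sub_mul_rho_mul_lagrangeSum {x : Pt n} (hx : Function.Injective x) {k : ℤ}
    (hk : (∀ i, x i ≠ 0) ∨ (n : ℤ) ≤ k) (c : ℝ) :
    ∑ a ∈ Finset.range (n + 1), (c - a) * rho (a : ℤ) x * lagrangeSum (k - a) x =
      ∑ i, x i ^ (k - n + 1) := by
  simp only [lagrangeSum, Finset.mul_sum]
  rw [Finset.sum_comm]
  refine Finset.sum_congr rfl fun i _ => ?_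
  have e : x i ^ (k - n + 1) = x i ^ (k - n) / Delta i x * (x i * Delta i x) := by
    have hD := Delta_ne_zero hx i
    have : x i ^ (k - n + 1) = x i ^ (k - n) * x i := by
      rcases hk with h | h
      · exact zpow_add_one₀ (h i) _
      · obtain ⟨q, hq⟩ := Int.eq_ofNat_of_zero_le (sub_nonneg.2 h)
        rw [hq]
        exact_mod_cast pow_succ (x i) q
    rw [this]
    field_simp
  rw [e, ← sum_sub_mul_rho_mul_pow x i c, Finset.mul_sum]
  refine Finset.sum_congr rfl fun a ha => ?_
  rw [zpow_sub_natCast (hk.imp (fun h => h i) id) (by simpa [Nat.lt_succ_iff] using ha)]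
  ring

/-- The partial sum with weights that computes the action of the Killing fields. -/
def killingSum (j : ℕ) (k : ℤ) (x : Pt n) : ℝ :=
  ∑ a ∈ Finset.range j, ((j : ℝ) - 1 - a) * rho (a : ℤ) x * lagrangeSum (k - a) x

/-- Choosing `c = j - 1` in the weighted identity makes the partial sum and its tail complementary.
The Killing fields of the first class see the partial sum, those of the second class the tail. -/
lemma killingSum_add {x : Pt n} (hx : Function.Injective x) {k : ℤ} {j : ℕ} (hj : j ≤ n)
    (hk : (∀ i, x i ≠ 0) ∨ (n : ℤ) ≤ k) :
    killingSum j k x + ∑ a ∈ Finset.Ico j (n + 1),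
      ((j : ℝ) - 1 - a) * rho (a : ℤ) x * lagrangeSum (k - a) x = ∑ i, x i ^ (k - n + 1) := by
  rw [killingSum, Finset.sum_range_add_sum_Ico _ (by omega : j ≤ n + 1)]
  exact sum_sub_mul_rho_mul_lagrangeSum hx hk _

lemma killingSum_of_lt {x : Pt n} (hx : Function.Injective x) {j : ℕ} (hj1 : 1 ≤ j)
    {γ : ℤ} (h0 : 0 ≤ γ) (h : γ ≤ n - j) :
    killingSum j (γ + j - 2) x = 0 := by
  refine Finset.sum_eq_zero fun a ha => ?_
  rw [Finset.mem_range] at ha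
  -- This term is removed by its weight: its Lagrange index `γ - 1` may be `-1`, outside the range
  -- of `lagrangeSum_of_lt`.
  by_cases h1 : a = j - 1
  · have : (j : ℝ) - 1 - a = 0 := by
      subst h1; push_cast [Nat.cast_sub hj1]; ring
    rw [this]; ring
  · rw [lagrangeSum_of_lt hx (by omega) (by omega), if_neg (by omega), mul_zero]

lemma killingSum_of_eq {x : Pt n} (hx : Function.Injective x) {j : ℕ} (hj1 : 1 ≤ j) (hj : j ≤ n)
    {γ : ℤ} (h : γ = n - j + 1) :
    killingSum j (γ + j - 2) x = (j : ℝ) - 1 := by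
  rw [killingSum, Finset.sum_eq_single_of_mem 0 (Finset.mem_range.2 hj1)]
  · by_cases h1 : j = 1
    · subst h1; simp
    rw [lagrangeSum_of_lt hx (by push_cast; omega) (by push_cast; omega),
      if_pos (by push_cast; omega)]
    simp [rho_zero]
  · intro a ha ha0
    rw [Finset.mem_range] at ha
    by_cases h1 : a = j - 1
    · have : (j : ℝ) - 1 - a = 0 := by
        subst h1; push_cast [Nat.cast_sub hj1]; ring
      rw [this]; ring
    · rw [lagrangeSum_of_lt hx (by omega) (by omega), if_neg (by omega), mul_zero]

/-- The tail `j ≤ a ≤ n` has Lagrange indices between `0` and `γ - 2 ≤ n - 1`. It is zero except for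
`a = j`, `γ = n + 1`, where the weight `-1` leaves `-ρ_j`. -/
lemma killingSum_of_gt {x : Pt n} (hx : Function.Injective x) {j : ℕ} (hj : j ≤ n)
    {γ : ℤ} (h : n - j + 2 ≤ γ) (h2 : γ ≤ n + 1) :
    killingSum j (γ + j - 2) x =
      ∑ i, x i ^ (γ + j - 1 - n) + if γ = n + 1 then rho j x else 0 := by
  have h3 := killingSum_add hx (k := γ + j - 2) hj (Or.inr (by omega))
  have e : γ + j - 2 - n + 1 = γ + j - 1 - n := by ring
  rw [e] at h3
  rw [← h3, add_assoc, left_eq_add,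
    Finset.sum_eq_single_of_mem j (by simp; omega)]
  · rw [lagrangeSum_of_lt hx (by omega) (by omega)]
    have : (γ + j - 2 - (j : ℤ) = n - 1) ↔ γ = n + 1 := by omega
    simp only [this]
    split_ifs <;> ring
  · intro a ha haj
    rw [Finset.mem_Ico] at ha
    rw [lagrangeSum_of_lt hx (by omega) (by omega), if_neg (by omega), mul_zero]

/-! ### Derivatives of the Viète coordinates -/

/-- The Viète coordinates with one variable left out. -/
def rhoErase (i : Fin n) (a : ℕ) (x : Pt n) : ℝ :=
  (-1) ^ a * ∑ s ∈ Finset.powersetCard a (Finset.univ.erase i), ∏ j ∈ s, x j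

/-- The subsets of size `a + 1` are split according to whether they contain `i`. -/
lemma rho_succ (i : Fin n) (a : ℕ) (x : Pt n) :
    rho ((a + 1 : ℕ) : ℤ) x = rhoErase i (a + 1) x - x i * rhoErase i a x := by
  rw [rho_natCast, rhoErase, rhoErase]
  conv_lhs => rw [← Finset.insert_erase (Finset.mem_univ i)]
  rw [Finset.powersetCard_succ_insert (Finset.notMem_erase _ _), Finset.sum_union, Finset.sum_image]
  · have : ∑ s ∈ Finset.powersetCard a (Finset.univ.erase i), ∏ j ∈ insert i s, x j =
        x i * ∑ s ∈ Finset.powersetCard a (Finset.univ.erase i), ∏ j ∈ s, x j := by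
      rw [Finset.mul_sum]
      refine Finset.sum_congr rfl fun s hs => Finset.prod_insert fun hi => ?_
      exact Finset.notMem_erase i _ ((Finset.mem_powersetCard.1 hs).1 hi)
    rw [this]
    ring
  · intro s hs t ht hst
    have hs' : i ∉ s := fun hi => Finset.notMem_erase i _ ((Finset.mem_powersetCard.1 hs).1 hi)
    have ht' : i ∉ t := fun hi => Finset.notMem_erase i _ ((Finset.mem_powersetCard.1 ht).1 hi)
    rw [← Finset.erase_insert hs', ← Finset.erase_insert ht']
    exact congrArg (fun u => u.erase i) hst
  · rw [Finset.disjoint_left]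
    intro s hs hs'
    obtain ⟨t, -, rfl⟩ := Finset.mem_image.1 hs'
    exact Finset.notMem_erase i _ ((Finset.mem_powersetCard.1 hs).1 (Finset.mem_insert_self _ _))

lemma rhoErase_eq_sum (i : Fin n) (a : ℕ) (x : Pt n) :
    rhoErase i a x = ∑ b ∈ Finset.range (a + 1), rho (b : ℤ) x * x i ^ (a - b) := by
  induction a with
  | zero => simp [rhoErase, rho_zero]
  | succ a ih =>
    rw [Finset.sum_range_succ]
    have h := rho_succ i a x
    have : rhoErase i (a + 1) x = x i * rhoErase i a x + rho ((a + 1 : ℕ) : ℤ) x := by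
      rw [h]; ring
    rw [this, ih, Finset.mul_sum]
    simp only [Nat.sub_self, pow_zero, mul_one, add_left_inj]
    refine Finset.sum_congr rfl fun b hb => ?_
    have hb' : b ≤ a := by simpa [Nat.lt_succ_iff] using hb
    rw [Nat.succ_sub hb', pow_succ]
    ring

lemma rhoErase_add_smul_single (i : Fin n) (a : ℕ) (x : Pt n) (s : ℝ) :
    rhoErase i a (x + s • Pi.single i 1) = rhoErase i a x := by
  unfold rhoErase
  congr 1
  refine Finset.sum_congr rfl fun u hu => Finset.prod_congr rfl fun j hj => ?_
  have : j ≠ i := Finset.ne_of_mem_erase ((Finset.mem_powersetCard.1 hu).1 hj)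
  simp [this]

lemma contDiff_rho (k : ℤ) : ContDiff ℝ ∞ (rho k : Pt n → ℝ) := by
  unfold rho
  split_ifs
  · exact contDiff_const
  · fun_prop

/-- By `rho_succ` the coordinate is affine in `x i`, with a slope that does not involve `x i`. -/
lemma pd_rho_succ (i : Fin n) (a : ℕ) (x : Pt n) :
    pd i (rho ((a + 1 : ℕ) : ℤ)) x = -rhoErase i a x := by
  have hd : DifferentiableAt ℝ (rho ((a + 1 : ℕ) : ℤ)) x :=
    (contDiff_rho _).differentiable (by simp) x
  rw [pd, ← hd.lineDeriv_eq_fderiv, lineDeriv]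
  have : (fun s : ℝ => rho ((a + 1 : ℕ) : ℤ) (x + s • Pi.single i 1)) =
      fun s => rhoErase i (a + 1) x - (x i + s) * rhoErase i a x := by
    funext s
    rw [rho_succ i, rhoErase_add_smul_single, rhoErase_add_smul_single]
    simp
  rw [this]
  have h : HasDerivAt (fun s : ℝ => rhoErase i (a + 1) x - (x i + s) * rhoErase i a x)
      (-(1 * rhoErase i a x)) 0 :=
    (((hasDerivAt_id (0 : ℝ)).const_add (x i)).mul_const _).const_sub _
  rw [h.deriv, one_mul]

/-! ### Separable potentials with exponents from 0 to n -/

lemma potV_eq_sum (x : Pt n) (r : Fin n) {α : ℤ} (hα : 0 ≤ α) :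
    potV α r x =
      -∑ b ∈ Finset.range (r + 1 : ℕ), rho (b : ℤ) x * lagrangeSum (α + r - b) x := by
  simp only [lagrangeSum, Finset.mul_sum, potV]
  rw [Finset.sum_comm, ← Finset.sum_neg_distrib]
  refine Finset.sum_congr rfl fun i _ => ?_
  have : idx r = ((r + 1 : ℕ) : ℤ) := by simp [idx]
  rw [this, pd_rho_succ, rhoErase_eq_sum, neg_mul, Finset.sum_mul]
  congr 1
  refine Finset.sum_congr rfl fun b hb => ?_
  have hb' : b ≤ r := by simpa [Nat.lt_succ_iff] using hb
  lift α to ℕ using hα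
  have e : (α : ℤ) + r - b = ((α + (r - b) : ℕ) : ℤ) := by omega
  rw [e, zpow_natCast, zpow_natCast, pow_add]
  ring

/-- For small `α` only the `b = 0` term can reach the index `n - 1`. For larger `α` the sum is
completed to the recurrence of the Lagrange sums, and every term of the added tail has index at most
`n - 2`. -/
lemma potV_of_le {x : Pt n} (hx : Function.Injective x) (r : Fin n) {α : ℤ} (h0 : 0 ≤ α)
    (hα : α ≤ n - 1) : potV α r x = if α = n - idx r then -1 else 0 := by
  have hr := r.2
  rw [potV_eq_sum x r h0]
  rcases lt_or_ge (α + r) n with h | h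
  · rw [Finset.sum_eq_single_of_mem 0 (by simp)]
    · rw [lagrangeSum_of_lt hx (by push_cast; omega) (by push_cast; omega)]
      have : (α + (r : ℤ) - ((0 : ℕ) : ℤ) = n - 1) ↔ α = n - idx r := by
        simp only [idx]; omega
      simp only [this]
      split_ifs <;> simp [rho_zero]
    · intro b hb hb0
      rw [Finset.mem_range] at hb
      rw [lagrangeSum_of_lt hx (by omega) (by omega), if_neg (by omega), mul_zero]
  · rw [if_neg (by simp only [idx]; omega), neg_eq_zero]
    have hs := sum_rho_mul_lagrangeSum (x := x) (k := α + r) (Or.inr h)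
    rw [← Finset.sum_range_add_sum_Ico _ (by omega : (r + 1 : ℕ) ≤ n + 1)] at hs
    rw [← hs, left_eq_add]
    refine Finset.sum_eq_zero fun b hb => ?_
    rw [Finset.mem_Ico] at hb
    rw [lagrangeSum_of_lt hx (by omega) (by omega), if_neg (by omega), mul_zero]

/-- Here the completing tail has one term of index `n - 1`, the first one, and it carries `ρ_r`. -/
lemma potV_natCast_self {x : Pt n} (hx : Function.Injective x) (r : Fin n) :
    potV n r x = rho (idx r) x := by
  have hr := r.2
  rw [potV_eq_sum x r (by omega)]
  have hs := sum_rho_mul_lagrangeSum (x := x) (k := n + r) (Or.inr (by omega))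
  rw [← Finset.sum_range_add_sum_Ico _ (by omega : (r + 1 : ℕ) ≤ n + 1)] at hs
  rw [neg_eq_iff_add_eq_zero, ← hs]
  congr 1
  rw [Finset.sum_eq_single_of_mem (r + 1 : ℕ) (by simp)]
  · rw [lagrangeSum_of_lt hx (by push_cast; omega) (by push_cast; omega),
      if_pos (by push_cast; omega)]
    simp [idx]
  · intro b hb hb0
    rw [Finset.mem_Ico] at hb
    rw [lagrangeSum_of_lt hx (by omega) (by omega), if_neg (by omega), mul_zero]

/-! ### Pairing of the Killing fields with powers of λ -/

lemma zpow_mul_zpow_sub {m : ℕ} {y : ℝ} (hy : m ≠ 0 → y ≠ 0) {p γ : ℤ} (hp : 0 ≤ p)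
    (hγ : 0 ≤ γ) : y ^ p * y ^ (γ - m) = y ^ (p + γ - m) := by
  by_cases hm : m = 0
  · subst hm
    lift p to ℕ using hp
    lift γ to ℕ using hγ
    simp only [Nat.cast_zero, sub_zero, ← Nat.cast_add, zpow_natCast, pow_add]
  · rw [← zpow_add₀ (hy hm), add_sub_assoc]

lemma sum_killingJ_mul_zpow {m : ℕ} {x : Pt n} (hx : x ∈ configSpace n m) (r : Fin n) {γ : ℤ}
    (hγ : 0 ≤ γ) :
    ∑ i, killingJ m r x i * x i ^ (γ - m) =
      -∑ k ∈ Finset.range n,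
        killingQ m (idx r) ((k : ℤ) + 1) x * lagrangeSum ((n : ℤ) - (k + 1) + γ - m) x := by
  rw [← Fin.sum_univ_eq_sum_range (fun k => killingQ m (idx r) ((k : ℤ) + 1) x *
    lagrangeSum ((n : ℤ) - (k + 1) + γ - m) x) n]
  simp only [lagrangeSum, killingJ, Finset.mul_sum, neg_mul, Finset.sum_mul]
  rw [Finset.sum_neg_distrib, Finset.sum_comm]
  congr 1
  refine Finset.sum_congr rfl fun k _ => Finset.sum_congr rfl fun i _ => ?_
  have hk := k.2
  rw [← zpow_mul_zpow_sub (fun h => hx.2 h i) (p := (n : ℤ) - (k + 1)) (by omega) hγ, idx, idx]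
  ring

lemma sum_killingJ_first {m : ℕ} {x : Pt n} (hx : x ∈ configSpace n m) (r : Fin n)
    (hr : InFirst n m (idx r)) {γ : ℤ} (hγ : 0 ≤ γ) :
    ∑ i, killingJ m r x i * x i ^ (γ - m) = -killingSum (r + 1) (γ + (r + 1 : ℕ) - 2) x := by
  rw [sum_killingJ_mul_zpow hx r hγ, killingSum, Finset.sum_range_succ]
  have h0 : (((r + 1 : ℕ) : ℝ) - 1 - ((r : ℕ) : ℝ)) = 0 := by push_cast; ring
  rw [h0, zero_mul, zero_mul, add_zero]
  congr 1
  have hr2 := r.2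
  by_cases hr0 : (r : ℕ) = 0
  · rw [hr0]
    simp only [Finset.range_zero, Finset.sum_empty]
    refine Finset.sum_eq_zero fun k _ => ?_
    rw [killingQ, if_neg (by simp [idx, hr0]), if_neg (by simp [idx, hr0]), zero_mul]
  have hr' : (r : ℤ) + 1 ≤ n - m + 1 := by
    rcases hr with h | h
    · simp only [idx] at h; omega
    · exact h
  symm
  -- The index is chosen so that `ρ_(m+r-n-2+k)` becomes `ρ_a`; the weight `n+1-m-k` then becomes
  -- `r-1-a` in one-based indices. Outside the image `killingQ` is zero.
  refine Finset.sum_of_injOn (fun a => a + n - m - r) ?_ ?_ ?_ ?_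
  · intro a _ b _ hab
    simp only at hab
    omega
  · intro a ha
    simp only [Finset.coe_range, Set.mem_Iio] at ha ⊢
    omega
  · intro k hk hk'
    rw [killingQ, if_pos (by simp only [idx]; omega), if_neg, zero_mul]
    rintro ⟨h1, h2⟩
    simp only [idx] at h1
    refine hk' ⟨k + m + r - n, ?_, ?_⟩
    · simp only [Finset.coe_range, Set.mem_Iio]; omega
    · simp only; omega
  · intro a ha
    rw [Finset.mem_range] at ha
    have e : ((a + n - m - r : ℕ) : ℤ) = a + n - m - r := by omega
    rw [killingQ, if_pos (by simp only [idx]; omega), if_pos (by simp only [idx]; omega), e]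
    have e1 : (m : ℤ) + idx r - n - 2 + (a + n - m - r + 1) = a := by simp only [idx]; ring
    have e2 : (n : ℤ) - (a + n - m - r + 1) + γ - m = γ + (r + 1 : ℕ) - 2 - a := by
      push_cast; ring
    rw [e1, e2]
    congr 2
    push_cast
    ring

/-- The same substitution now runs over the complementary range `r ≤ a ≤ n` (one-based `r`), with
the opposite sign. The pairing is therefore the tail in `killingSum_add`. Negative exponents can
occur, but this class is nonempty only for `m ≥ 2`, when all entries are nonzero. -/
lemma sum_killingJ_second {m : ℕ} (hm : m ≤ n + 1) {x : Pt n} (hx : x ∈ configSpace n m)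
    (r : Fin n) (hr : ¬InFirst n m (idx r)) {γ : ℤ} (hγ : 0 ≤ γ) :
    ∑ i, killingJ m r x i * x i ^ (γ - m) =
      ∑ i, x i ^ (γ + idx r - 1 - n) - killingSum (r + 1) (γ + (r + 1 : ℕ) - 2) x := by
  have hr2 := r.2
  obtain ⟨hr0, hr'⟩ : (r : ℤ) ≠ 0 ∧ (n : ℤ) - m + 1 < r + 1 := by
    simp only [InFirst, idx, not_or, not_le] at hr
    omega
  have hm0 : m ≠ 0 := by omega
  have h := killingSum_add hx.1 (k := γ + (r + 1 : ℕ) - 2) (j := r + 1) (by omega)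
    (Or.inl (hx.2 hm0))
  have e : γ + (r + 1 : ℕ) - 2 - n + 1 = γ + idx r - 1 - n := by simp only [idx]; push_cast; ring
  rw [e] at h
  rw [sum_killingJ_mul_zpow hx r hγ, ← h, add_sub_cancel_left, neg_eq_iff_eq_neg,
    ← Finset.sum_neg_distrib]
  symm
  refine Finset.sum_of_injOn (fun a => a + n - m - r) ?_ ?_ ?_ ?_
  · intro a ha b hb hab
    simp only [Finset.coe_Ico, Set.mem_Ico] at hab ha hb
    omega
  · intro a ha
    simp only [Finset.coe_range, Finset.coe_Ico, Set.mem_Ico, Set.mem_Iio] at ha ⊢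
    omega
  · intro k hk hk'
    rw [killingQ, if_neg (by simp only [idx]; omega), if_pos (by simp only [idx]; omega), if_neg,
      zero_mul]
    rintro ⟨h1, h2⟩
    simp only [idx] at h2
    refine hk' ⟨k + m + r - n, ?_, ?_⟩
    · simp only [Finset.coe_Ico, Set.mem_Ico]; omega
    · simp only; omega
  · intro a ha
    rw [Finset.mem_Ico] at ha
    have e : ((a + n - m - r : ℕ) : ℤ) = a + n - m - r := by omega
    rw [killingQ, if_neg (by simp only [idx]; omega), if_pos (by simp only [idx]; omega),
      if_pos (by simp only [idx]; omega), e]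
    have e1 : (m : ℤ) + idx r - n - 2 + (a + n - m - r + 1) = a := by simp only [idx]; ring
    have e2 : (n : ℤ) - (a + n - m - r + 1) + γ - m = γ + (r + 1 : ℕ) - 2 - a := by
      push_cast; ring
    rw [e1, e2]
    push_cast
    ring

/-! ### The phase and the comparison of scalar potentials -/

/-- The real phase `∑ a_γ λ_j^{γ-m+1} / (γ-m+1)` with coefficients `a_γ`. -/
def phaseSum (m : ℕ) (a : ℤ → ℝ) (x : Pt n) : ℝ :=
  ∑ γ ∈ Finset.Icc (0 : ℤ) (n + 1), a γ * ∑ j, primPow (γ - m) (x j)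

/-- The gradient of `phaseSum`. -/
def phaseGrad (m : ℕ) (a : ℤ → ℝ) (x : Pt n) (j : Fin n) : ℝ :=
  ∑ γ ∈ Finset.Icc (0 : ℤ) (n + 1), a γ * x j ^ (γ - m)

/-- The scalar potential of `ĥ_r^A`. -/
def scalarA (m : ℕ) (c : ℤ → Pt n → ℝ) (r : Fin n) (t x : Pt n) : ℝ :=
  ∑ α ∈ Finset.Icc (-(m : ℤ)) (2 * n - m + 2), c α t * potV α r x

/-- The scalar potential of the gauge transform of `ĥ_r^B`. -/
def scalarB [NeZero n] (m : ℕ) (d : ℤ → Pt n → ℝ) (bbar : ℝ) (e : ℤ → Pt n → ℝ)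
    (r : Fin n) (t x : Pt n) : ℝ :=
  (1 / 2) * (∑ γ ∈ Finset.Icc (0 : ℤ) (n + 1), ∑ γ' ∈ Finset.Icc (0 : ℤ) (n + 1),
      d γ t * d γ' t * potV (γ + γ' - m) r x) +
    ∑ i, killingJ m r x i * phaseGrad m (fun γ => d γ t) x i +
    (bbar * eTop n m t * potV n r x - bbar * e (n - idx r) t)

lemma sum_killingJ_mul_phaseGrad (m : ℕ) (a : ℤ → ℝ) (r : Fin n) (x : Pt n) :
    ∑ i, killingJ m r x i * phaseGrad m a x i =
      ∑ γ ∈ Finset.Icc (0 : ℤ) (n + 1), a γ * ∑ i, killingJ m r x i * x i ^ (γ - m) := by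
  simp only [phaseGrad, Finset.mul_sum]
  rw [Finset.sum_comm]
  refine Finset.sum_congr rfl fun γ _ => Finset.sum_congr rfl fun i _ => ?_
  ring

lemma killingSum_eq {x : Pt n} (hx : Function.Injective x) (r : Fin n) {γ : ℤ}
    (h0 : 0 ≤ γ) (h1 : γ ≤ n + 1) :
    killingSum (r + 1) (γ + (r + 1 : ℕ) - 2) x =
      (if γ = n - idx r + 1 then ((idx r : ℤ) : ℝ) - 1 else 0) +
      (if n - idx r + 2 ≤ γ then ∑ i, x i ^ (γ + idx r - 1 - n) else 0) +
      (if γ = n + 1 then rho (idx r) x else 0) := by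
  have hr := r.2
  have hi : idx r = ((r + 1 : ℕ) : ℤ) := by simp [idx]
  rw [hi]
  rcases lt_trichotomy γ (n - (r + 1 : ℕ) + 1) with h | h | h
  · rw [killingSum_of_lt hx (by omega) h0 (by omega), if_neg (by omega), if_neg (by omega),
      if_neg (by omega)]
    simp
  · rw [killingSum_of_eq hx (by omega) (by omega) h, if_pos h, if_neg (by omega),
      if_neg (by omega)]
    push_cast
    ring
  · have a1 : ¬(γ = n - (r + 1 : ℕ) + 1) := h.ne'
    have a2 : (n : ℤ) - (r + 1 : ℕ) + 2 ≤ γ := by omega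
    rw [killingSum_of_gt hx (by omega) (by omega) h1, if_neg a1, if_pos a2, zero_add]

/-- Every exponent `γ + γ' - m` lies in the range of `α`, so the quadratic part regroups without
loss. Of the `ε_α` only `α = n - r` survives, with factor `-1`, by `potV_of_le`. -/
lemma scalarA_cOf [NeZero n] {m : ℕ} (hm : m ≤ n + 1) (d : ℤ → Pt n → ℝ) (bbar : ℝ)
    (e : ℤ → Pt n → ℝ) (r : Fin n) (t : Pt n) {x : Pt n} (hx : Function.Injective x) :
    scalarA m (cOf m d bbar e) r t x =
      (1 / 2) * (∑ γ ∈ Finset.Icc (0 : ℤ) (n + 1), ∑ γ' ∈ Finset.Icc (0 : ℤ) (n + 1),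
        d γ t * d γ' t * potV (γ + γ' - m) r x) +
      (bbar * eTop n m t - d (n + 1) t) * potV n r x -
      (bbar * e (n - idx r) t + open Classical in
        (if InFirst n m (idx r) then ((idx r - 1 : ℤ) : ℝ) * d (n - idx r + 1) t
          else -((n - idx r + 1 : ℤ) : ℝ) * d (n - idx r + 1) t)) := by
  classical
  have hr := r.2
  simp only [scalarA, cOf, add_mul, Finset.sum_add_distrib]
  rw [sub_eq_add_neg]
  congr 1
  · congr 1
    · simp only [mul_assoc (1 / 2 : ℝ)]
      rw [← Finset.mul_sum]
      congr 1
      simp only [Finset.sum_mul]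
      rw [Finset.sum_comm]
      refine Finset.sum_congr rfl fun γ hγ => ?_
      rw [Finset.sum_comm]
      refine Finset.sum_congr rfl fun γ' hγ' => ?_
      rw [Finset.mem_Icc] at hγ hγ'
      rw [Finset.sum_eq_single_of_mem (γ + γ' - m) (by rw [Finset.mem_Icc]; omega)]
      · rw [if_pos rfl, mul_assoc]
      · intro α _ hα
        rw [if_neg hα.symm, zero_mul]
    · rw [Finset.sum_eq_single_of_mem (n : ℤ) (by rw [Finset.mem_Icc]; omega)]
      · rw [if_pos rfl]
      · intro α _ hα
        rw [if_neg hα, zero_mul]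
  · rw [Finset.sum_eq_single_of_mem (n - idx r : ℤ)
      (by rw [Finset.mem_Icc]; simp only [idx]; omega)]
    · rw [if_pos (by simp only [idx]; omega), potV_of_le hx r (by simp only [idx]; omega)
        (by simp only [idx]; omega), if_pos rfl, mul_neg_one]
      have e1 : (n : ℤ) - (n - idx r) = idx r := by ring
      rw [e1]
    · intro α _ hα
      split_ifs with h
      · rw [potV_of_le hx r h.1 h.2, if_neg hα, mul_zero]
      · rw [potV_of_le hx r h.1 h.2, if_neg hα, mul_zero]
      · rw [zero_mul]

/-- The quadratic and `b̄` terms agree. The constant and the `ρ_r` term of the Killing pairing are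
absorbed by `ε_(n-r)` and by `-d_(n+1)` in `c_n`, so only power sums remain. -/
lemma scalarA_sub_scalarB_first [NeZero n] {m : ℕ} (hm : m ≤ n + 1) (d : ℤ → Pt n → ℝ)
    (bbar : ℝ) (e : ℤ → Pt n → ℝ) (r : Fin n) (hr : InFirst n m (idx r)) (t : Pt n) {x : Pt n}
    (hx : x ∈ configSpace n m) :
    scalarA m (cOf m d bbar e) r t x - scalarB m d bbar e r t x =
      ∑ γ ∈ Finset.Icc (0 : ℤ) (n + 1),
        if n - idx r + 2 ≤ γ then d γ t * ∑ i, x i ^ (γ + idx r - 1 - n) else 0 := by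
  have hr2 := r.2
  rw [scalarA_cOf hm d bbar e r t hx.1, scalarB, sum_killingJ_mul_phaseGrad, if_pos hr,
    potV_natCast_self hx.1]
  have h : ∑ γ ∈ Finset.Icc (0 : ℤ) (n + 1), d γ t * ∑ i, killingJ m r x i * x i ^ (γ - m) =
      -(d (n - idx r + 1) t * (((idx r : ℤ) : ℝ) - 1)) -
      (∑ γ ∈ Finset.Icc (0 : ℤ) (n + 1),
        if n - idx r + 2 ≤ γ then d γ t * ∑ i, x i ^ (γ + idx r - 1 - n) else 0) -
      d (n + 1) t * rho (idx r) x := by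
    have h1 : ∑ γ ∈ Finset.Icc (0 : ℤ) (n + 1),
        (if γ = n - idx r + 1 then d γ t * (((idx r : ℤ) : ℝ) - 1) else 0) =
        d (n - idx r + 1) t * (((idx r : ℤ) : ℝ) - 1) := by
      rw [Finset.sum_ite_eq', if_pos (by rw [Finset.mem_Icc]; simp only [idx]; omega)]
    have h2 : ∑ γ ∈ Finset.Icc (0 : ℤ) (n + 1),
        (if γ = n + 1 then d γ t * rho (idx r) x else 0) = d (n + 1) t * rho (idx r) x := by
      rw [Finset.sum_ite_eq', if_pos (by rw [Finset.mem_Icc]; omega)]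
    rw [← h1, ← h2, ← Finset.sum_neg_distrib, ← Finset.sum_sub_distrib, ← Finset.sum_sub_distrib]
    refine Finset.sum_congr rfl fun γ hγ => ?_
    rw [Finset.mem_Icc] at hγ
    rw [sum_killingJ_first hx r hr hγ.1, killingSum_eq hx.1 r hγ.1 hγ.2]
    split_ifs <;> ring
  rw [h]
  push_cast
  ring

lemma scalarA_sub_scalarB_second [NeZero n] {m : ℕ} (hm : m ≤ n + 1) (d : ℤ → Pt n → ℝ)
    (bbar : ℝ) (e : ℤ → Pt n → ℝ) (r : Fin n) (hr : ¬InFirst n m (idx r)) (t : Pt n) {x : Pt n}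
    (hx : x ∈ configSpace n m) :
    scalarA m (cOf m d bbar e) r t x - scalarB m d bbar e r t x =
      -∑ γ ∈ Finset.Icc (0 : ℤ) (n + 1),
        if γ ≤ n - idx r then d γ t * ∑ i, x i ^ (γ + idx r - 1 - n) else 0 := by
  have hr2 := r.2
  rw [scalarA_cOf hm d bbar e r t hx.1, scalarB, sum_killingJ_mul_phaseGrad, if_neg hr,
    potV_natCast_self hx.1]
  have h : ∑ γ ∈ Finset.Icc (0 : ℤ) (n + 1), d γ t * ∑ i, killingJ m r x i * x i ^ (γ - m) =
      d (n - idx r + 1) t * ((n : ℝ) - ((idx r : ℤ) : ℝ) + 1) +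
      (∑ γ ∈ Finset.Icc (0 : ℤ) (n + 1),
        if γ ≤ n - idx r then d γ t * ∑ i, x i ^ (γ + idx r - 1 - n) else 0) -
      d (n + 1) t * rho (idx r) x := by
    have h1 : ∑ γ ∈ Finset.Icc (0 : ℤ) (n + 1),
        (if γ = n - idx r + 1 then d γ t * ((n : ℝ) - ((idx r : ℤ) : ℝ) + 1) else 0) =
        d (n - idx r + 1) t * ((n : ℝ) - ((idx r : ℤ) : ℝ) + 1) := by
      rw [Finset.sum_ite_eq', if_pos (by rw [Finset.mem_Icc]; simp only [idx]; omega)]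
    have h2 : ∑ γ ∈ Finset.Icc (0 : ℤ) (n + 1),
        (if γ = n + 1 then d γ t * rho (idx r) x else 0) = d (n + 1) t * rho (idx r) x := by
      rw [Finset.sum_ite_eq', if_pos (by rw [Finset.mem_Icc]; omega)]
    rw [← h1, ← h2, ← Finset.sum_add_distrib, ← Finset.sum_sub_distrib]
    refine Finset.sum_congr rfl fun γ hγ => ?_
    rw [Finset.mem_Icc] at hγ
    rw [sum_killingJ_second hm hx r hr hγ.1, killingSum_eq hx.1 r hγ.1 hγ.2]
    rcases lt_trichotomy γ (n - idx r + 1) with h | h | h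
    · have a1 : ¬(γ = n - idx r + 1) := h.ne
      have a2 : ¬((n : ℤ) - idx r + 2 ≤ γ) := by omega
      have a3 : γ ≤ n - idx r := by omega
      simp only [if_neg a1, if_neg a2, if_pos a3]
      split_ifs <;> ring
    · have a2 : ¬((n : ℤ) - idx r + 2 ≤ γ) := by omega
      have a3 : ¬(γ ≤ n - idx r) := by omega
      -- The power sum of exponent zero equals `n`; together with `-(r-1)` it gives the coefficient
      -- `n-r+1` occurring in `ε_(n-r)`.
      have e1 : γ + idx r - 1 - n = 0 := by omega
      simp only [if_pos h, if_neg a2, if_neg a3, e1, zpow_zero, Finset.sum_const, Finset.card_univ,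
        Fintype.card_fin, nsmul_eq_mul]
      split_ifs <;> ring
    · have a1 : ¬(γ = n - idx r + 1) := h.ne'
      have a2 : (n : ℤ) - idx r + 2 ≤ γ := by omega
      have a3 : ¬(γ ≤ n - idx r) := by omega
      simp only [if_neg a1, if_pos a2, if_neg a3]
      split_ifs <;> ring
  rw [h]
  push_cast
  ring

/-! ### The linear PDE system as the time derivative of the phase -/

/-- The first class is closed under decreasing the index and its complement under increasing it, so
a deformation never mixes the two formulas for the potential difference. -/
lemma inFirst_iff_of_deformCoeff_ne_zero {m : ℕ} {ζ : Fin n → Fin n → Pt n → ℝ} {r j : Fin n}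
    {t : Pt n} (h : deformCoeff m ζ r j t ≠ 0) : InFirst n m (idx r) ↔ InFirst n m (idx j) := by
  by_cases hj : j = r
  · rw [hj]
  rw [deformCoeff, if_neg hj] at h
  by_cases hr : InFirst n m (idx r)
  · rw [if_pos hr] at h
    have h1 : j < r := by
      by_contra h2
      exact h (if_neg fun h3 => h2 h3.2)
    refine iff_of_true hr ?_
    have : (j : ℕ) < r := h1
    unfold InFirst idx at hr ⊢
    omega
  · rw [if_neg hr] at h
    have h1 : r < j := by
      by_contra h2
      exact h (if_neg fun h3 => h2 h3.2)
    refine iff_of_false hr ?_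
    have : (r : ℕ) < j := h1
    unfold InFirst idx at hr ⊢
    omega

lemma mul_primPow {k : ℤ} (hk : k ≠ -1) (s : ℝ) : ((k + 1 : ℤ) : ℝ) * primPow k s = s ^ (k + 1) := by
  have : ((k + 1 : ℤ) : ℝ) ≠ 0 := by
    rw [Int.cast_ne_zero]; omega
  rw [primPow, if_neg hk, mul_div_cancel₀ _ this]

lemma mul_sum_primPow {k : ℤ} (hk : k ≠ -1) (x : Pt n) :
    ((k + 1 : ℤ) : ℝ) * ∑ i, primPow k (x i) = ∑ i, x i ^ (k + 1) := by
  rw [Finset.mul_sum]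
  exact Finset.sum_congr rfl fun i _ => mul_primPow hk _

lemma sum_shift_first {m : ℕ} (hm : m ≤ n + 1) (a : ℤ → ℝ) (j : Fin n)
    (hj : InFirst n m (idx j)) (x : Pt n) :
    ∑ γ ∈ Finset.Icc (0 : ℤ) (n + 1), (if (m : ℤ) ≤ γ then
        (if 0 ≤ γ + n + 2 - m - idx j ∧ γ + n + 2 - m - idx j ≤ n + 1
          then a (γ + n + 2 - m - idx j) else 0) * ∑ i, x i ^ (γ - m + 1) else 0) =
      ∑ γ ∈ Finset.Icc (0 : ℤ) (n + 1),
        if n - idx j + 2 ≤ γ then a γ * ∑ i, x i ^ (γ + idx j - 1 - n) else 0 := by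
  have hj2 := j.2
  unfold InFirst at hj
  have hi : idx j = (j : ℤ) + 1 := rfl
  simp only [ite_mul, zero_mul, ← ite_and]
  rw [← Finset.sum_filter, ← Finset.sum_filter]
  -- With `β = γ+n+2-m-j`, the cutoff `m ≤ γ` becomes `n-j+2 ≤ β`. The bound `γ ≤ n+1` costs nothing
  -- because `j` is in the first class and `m ≤ n+1`.
  refine Finset.sum_nbij' (fun γ => γ + n + 2 - m - idx j) (fun β => β - n - 2 + m + idx j)
    ?_ ?_ ?_ ?_ ?_
  · intro γ hγ
    simp only [Finset.mem_filter, Finset.mem_Icc] at hγ ⊢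
    omega
  · intro γ hγ
    simp only [Finset.mem_filter, Finset.mem_Icc] at hγ ⊢
    omega
  · intro γ _; ring
  · intro γ _; ring
  · intro γ _
    have : γ + n + 2 - m - idx j + idx j - 1 - n = γ - m + 1 := by ring
    rw [this]

lemma sum_shift_second {m : ℕ} (a : ℤ → ℝ) (j : Fin n) (hm : m ≤ n + 1)
    (hj : ¬InFirst n m (idx j)) (x : Pt n) :
    ∑ γ ∈ Finset.Icc (0 : ℤ) (n + 1), (if γ ≤ (m : ℤ) - 2 then
        (if 0 ≤ γ + n + 2 - m - idx j ∧ γ + n + 2 - m - idx j ≤ n + 1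
          then a (γ + n + 2 - m - idx j) else 0) * ∑ i, x i ^ (γ - m + 1) else 0) =
      ∑ γ ∈ Finset.Icc (0 : ℤ) (n + 1),
        if γ ≤ n - idx j then a γ * ∑ i, x i ^ (γ + idx j - 1 - n) else 0 := by
  have hj2 := j.2
  unfold InFirst at hj
  have hi : idx j = (j : ℤ) + 1 := rfl
  simp only [ite_mul, zero_mul, ← ite_and]
  rw [← Finset.sum_filter, ← Finset.sum_filter]
  -- Here `γ ≤ m-2` becomes `β ≤ n-j`, and `γ ≥ β` because `j ≥ n-m+2`, so no term is lost at `γ <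
  -- 0`.
  refine Finset.sum_nbij' (fun γ => γ + n + 2 - m - idx j) (fun β => β - n - 2 + m + idx j)
    ?_ ?_ ?_ ?_ ?_
  · intro γ hγ
    simp only [Finset.mem_filter, Finset.mem_Icc] at hγ ⊢
    omega
  · intro γ hγ
    simp only [Finset.mem_filter, Finset.mem_Icc] at hγ ⊢
    omega
  · intro γ _; ring
  · intro γ _; ring
  · intro γ _
    have : γ + n + 2 - m - idx j + idx j - 1 - n = γ - m + 1 := by ring
    rw [this]

/-- The PDE system matches the scalar potentials of the two deformed families. -/
lemma sum_deformCoeff_scalar [NeZero n] {m : ℕ} (hm : m ≤ n + 1)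
    {ζ : Fin n → Fin n → Pt n → ℝ} {d : ℤ → Pt n → ℝ} {T : Set (Pt n)}
    (hPDE : PDESystem m ζ d T) (bbar : ℝ) (e : ℤ → Pt n → ℝ) (r : Fin n) {t : Pt n} (ht : t ∈ T)
    {x : Pt n} (hx : x ∈ configSpace n m) :
    ∑ j, deformCoeff m ζ r j t *
        (scalarA m (cOf m d bbar e) j t x - scalarB m d bbar e j t x) =
      phaseSum m (fun γ => pd r (d γ) t) x := by
  classical
  by_cases hr : InFirst n m (idx r)
  · have h1 : ∀ j, deformCoeff m ζ r j t *
        (scalarA m (cOf m d bbar e) j t x - scalarB m d bbar e j t x) =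
        deformCoeff m ζ r j t * ∑ γ ∈ Finset.Icc (0 : ℤ) (n + 1), (if (m : ℤ) ≤ γ then
        (if 0 ≤ γ + n + 2 - m - idx j ∧ γ + n + 2 - m - idx j ≤ n + 1
          then d (γ + n + 2 - m - idx j) t else 0) * ∑ i, x i ^ (γ - m + 1) else 0) := by
      intro j
      by_cases h0 : deformCoeff m ζ r j t = 0
      · rw [h0, zero_mul, zero_mul]
      · have hj := (inFirst_iff_of_deformCoeff_ne_zero h0).1 hr
        rw [scalarA_sub_scalarB_first hm d bbar e j hj t hx,
          sum_shift_first hm (fun γ => d γ t) j hj]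
    rw [Finset.sum_congr rfl fun j _ => h1 j]
    simp only [Finset.mul_sum (s := Finset.Icc (0 : ℤ) (n + 1))]
    rw [Finset.sum_comm, phaseSum]
    refine Finset.sum_congr rfl fun γ hγ => ?_
    simp only [hPDE t ht r γ hγ]
    rw [if_pos hr]
    by_cases hmγ : (m : ℤ) ≤ γ
    · simp only [if_pos hmγ]
      -- The PDE factor `γ-m+1` cancels the denominator of the primitive. The logarithmic exponent
      -- `γ = m-1` is excluded in both classes: its coefficient does not depend on time.
      rw [← mul_sum_primPow (by omega), shiftSum]
      simp only [← mul_assoc, ← Finset.sum_mul]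
      ring
    · simp [if_neg hmγ]
  · have h1 : ∀ j, deformCoeff m ζ r j t *
        (scalarA m (cOf m d bbar e) j t x - scalarB m d bbar e j t x) =
        -(deformCoeff m ζ r j t * ∑ γ ∈ Finset.Icc (0 : ℤ) (n + 1), (if γ ≤ (m : ℤ) - 2 then
        (if 0 ≤ γ + n + 2 - m - idx j ∧ γ + n + 2 - m - idx j ≤ n + 1
          then d (γ + n + 2 - m - idx j) t else 0) * ∑ i, x i ^ (γ - m + 1) else 0)) := by
      intro j
      by_cases h0 : deformCoeff m ζ r j t = 0
      · rw [h0, zero_mul, zero_mul, neg_zero]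
      · have hj := (not_congr (inFirst_iff_of_deformCoeff_ne_zero h0)).1 hr
        rw [scalarA_sub_scalarB_second hm d bbar e j hj t hx,
          sum_shift_second (fun γ => d γ t) j hm hj, mul_neg]
    rw [Finset.sum_congr rfl fun j _ => h1 j, Finset.sum_neg_distrib]
    simp only [Finset.mul_sum (s := Finset.Icc (0 : ℤ) (n + 1))]
    rw [Finset.sum_comm, phaseSum, ← Finset.sum_neg_distrib]
    refine Finset.sum_congr rfl fun γ hγ => ?_
    simp only [hPDE t ht r γ hγ]
    rw [if_neg hr]
    by_cases hmγ : γ ≤ (m : ℤ) - 2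
    · simp only [if_pos hmγ]
      rw [← mul_sum_primPow (by omega), shiftSum]
      simp only [← mul_assoc, ← Finset.sum_mul]
      ring
    · simp [if_neg hmγ]

/-! ### Partial derivatives -/

section PartialDerivatives

variable {A : Type*} [NormedCommRing A] [NormedAlgebra ℝ A]

lemma pd_congr_of_isOpen {f g : Pt n → A} {s : Set (Pt n)} (hs : IsOpen s)
    (h : ∀ y ∈ s, f y = g y) (k : Fin n) {x : Pt n} (hx : x ∈ s) : pd k f x = pd k g x := by
  have : f =ᶠ[nhds x] g := Filter.eventually_of_mem (hs.mem_nhds hx) h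
  rw [pd, pd, this.fderiv_eq]

lemma pd_add {f g : Pt n → A} (k : Fin n) {x : Pt n} (hf : DifferentiableAt ℝ f x)
    (hg : DifferentiableAt ℝ g x) : pd k (fun y => f y + g y) x = pd k f x + pd k g x := by
  rw [pd, fderiv_fun_add hf hg]
  rfl

lemma pd_mul {f g : Pt n → A} (k : Fin n) {x : Pt n} (hf : DifferentiableAt ℝ f x)
    (hg : DifferentiableAt ℝ g x) :
    pd k (fun y => f y * g y) x = pd k f x * g x + f x * pd k g x := by
  rw [pd, fderiv_fun_mul hf hg]
  simp only [pd, _root_.add_apply, _root_.smul_apply, smul_eq_mul]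
  ring

lemma pd_const (c : A) (k : Fin n) (x : Pt n) : pd k (fun _ => c) x = 0 := by
  simp [pd]

lemma pd_const_mul {f : Pt n → A} (c : A) (k : Fin n) {x : Pt n}
    (hf : DifferentiableAt ℝ f x) : pd k (fun y => c * f y) x = c * pd k f x := by
  rw [pd_mul k (differentiableAt_const c) hf, pd_const, zero_mul, zero_add]

lemma pd_mul_const {f : Pt n → A} (c : A) (k : Fin n) {x : Pt n}
    (hf : DifferentiableAt ℝ f x) : pd k (fun y => f y * c) x = pd k f x * c := by
  rw [pd_mul k hf (differentiableAt_const c), pd_const, mul_zero, add_zero]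

lemma pd_sum {ι : Type*} (u : Finset ι) {f : ι → Pt n → A} (k : Fin n) {x : Pt n}
    (hf : ∀ i ∈ u, DifferentiableAt ℝ (f i) x) :
    pd k (fun y => ∑ i ∈ u, f i y) x = ∑ i ∈ u, pd k (f i) x := by
  rw [pd, fderiv_fun_sum hf, _root_.sum_apply]
  rfl

lemma contDiffOn_pd {f : Pt n → A} {s : Set (Pt n)} (hs : IsOpen s) (hf : ContDiffOn ℝ ∞ f s)
    (k : Fin n) : ContDiffOn ℝ ∞ (pd k f) s :=
  (hf.fderiv_of_isOpen hs (by simp)).clm_apply contDiffOn_const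

lemma differentiableAt_of_contDiffOn {f : Pt n → A} {s : Set (Pt n)} (hs : IsOpen s)
    (hf : ContDiffOn ℝ ∞ f s) {x : Pt n} (hx : x ∈ s) : DifferentiableAt ℝ f x :=
  (hf.contDiffAt (hs.mem_nhds hx)).differentiableAt (by simp)

end PartialDerivatives

lemma contDiffOn_ofReal {f : Pt n → ℝ} {s : Set (Pt n)} (hf : ContDiffOn ℝ ∞ f s) :
    ContDiffOn ℝ ∞ (fun y => (f y : ℂ)) s :=
  Complex.ofRealCLM.contDiff.comp_contDiffOn hf

lemma pd_ofReal {f : Pt n → ℝ} (k : Fin n) {x : Pt n} (hf : DifferentiableAt ℝ f x) :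
    pd k (fun y => (f y : ℂ)) x = ((pd k f x : ℝ) : ℂ) := by
  have h : HasFDerivAt (fun y => (f y : ℂ)) (Complex.ofRealCLM.comp (fderiv ℝ f x)) x :=
    Complex.ofRealCLM.hasFDerivAt.comp x hf.hasFDerivAt
  rw [pd, h.fderiv]
  rfl

lemma pd_cexp {f : Pt n → ℂ} (k : Fin n) {x : Pt n} (hf : DifferentiableAt ℝ f x) :
    pd k (fun y => Complex.exp (f y)) x = Complex.exp (f x) * pd k f x := by
  have h := hf.hasFDerivAt.cexp
  rw [pd, h.fderiv]
  rfl

/-! ### Smoothness on the configuration space -/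

lemma isOpen_configSpace (n m : ℕ) : IsOpen (configSpace n m) := by
  have : configSpace n m = (⋂ i : Fin n, ⋂ j : Fin n, {x | i ≠ j → x i ≠ x j}) ∩
      ⋂ j : Fin n, {x | m ≠ 0 → x j ≠ 0} := by
    ext x
    simp only [configSpace, Set.mem_ofPred_eq, Set.mem_inter_iff, Set.mem_iInter]
    refine and_congr ⟨fun h i j hij hx => hij (h hx), fun h i j hx => ?_⟩
      ⟨fun h j hm => h hm j, fun h hm j => h j hm⟩
    by_contra hij
    exact h i j hij hx
  rw [this]
  refine (isOpen_iInter_of_finite fun i => isOpen_iInter_of_finite fun j => ?_).inter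
    (isOpen_iInter_of_finite fun j => ?_)
  · by_cases h : i = j
    · simp [h]
    · simp only [ne_eq, h, not_false_eq_true, true_imp_iff]
      exact isOpen_ne_fun (continuous_apply i) (continuous_apply j)
  · by_cases h : m = 0
    · simp [h]
    · simp only [ne_eq, h, not_false_eq_true, true_imp_iff]
      exact isOpen_ne_fun (continuous_apply j) continuous_const

lemma contDiffOn_apply (j : Fin n) (s : Set (Pt n)) : ContDiffOn ℝ ∞ (fun x : Pt n => x j) s :=
  (contDiff_apply ℝ ℝ j).contDiffOn

/-- A negative exponent forces `m ≠ 0`, and then the entries are nonzero on the configuration space.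
-/
lemma contDiffOn_zpow {m : ℕ} (j : Fin n) {k : ℤ} (hk : -(m : ℤ) ≤ k) :
    ContDiffOn ℝ ∞ (fun x : Pt n => x j ^ k) (configSpace n m) := by
  rcases le_or_gt 0 k with h | h
  · lift k to ℕ using h
    simpa only [zpow_natCast] using (contDiffOn_apply j _).pow k
  · have hm : m ≠ 0 := by omega
    obtain ⟨q, rfl⟩ : ∃ q : ℕ, k = -q := ⟨(-k).toNat, by omega⟩
    simp only [zpow_neg, zpow_natCast]
    exact ((contDiffOn_apply j _).pow q).inv fun x hx => pow_ne_zero q (hx.2 hm j)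

lemma contDiffOn_zpow_sub {m : ℕ} (j : Fin n) {γ : ℤ} (hγ : 0 ≤ γ) :
    ContDiffOn ℝ ∞ (fun x : Pt n => x j ^ (γ - m)) (configSpace n m) :=
  contDiffOn_zpow j (by omega)

lemma contDiffOn_Delta (m : ℕ) (j : Fin n) :
    ContDiffOn ℝ ∞ (Delta j) (configSpace n m) :=
  contDiffOn_prod fun k _ => (contDiffOn_apply j _).sub (contDiffOn_apply k _)

lemma contDiffOn_zpow_div_Delta {m : ℕ} (j : Fin n) {k : ℤ} (hk : -(m : ℤ) ≤ k) :
    ContDiffOn ℝ ∞ (fun x : Pt n => x j ^ k / Delta j x) (configSpace n m) :=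
  (contDiffOn_zpow j hk).div (contDiffOn_Delta m j) fun _ hx => Delta_ne_zero hx.1 j

lemma contDiffOn_pd_rho (m : ℕ) (i : Fin n) (k : ℤ) :
    ContDiffOn ℝ ∞ (fun x => pd i (rho k) x) (configSpace n m) :=
  contDiffOn_pd (isOpen_configSpace n m) (contDiff_rho k).contDiffOn i

lemma contDiffOn_vecP {m : ℕ} (r j : Fin n) {γ : ℤ} (hγ : -(m : ℤ) ≤ γ) :
    ContDiffOn ℝ ∞ (fun x => vecP γ r x j) (configSpace n m) :=
  (contDiffOn_pd_rho m j _).mul (contDiffOn_zpow_div_Delta j hγ)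

lemma contDiffOn_potV {m : ℕ} (r : Fin n) {α : ℤ} (hα : -(m : ℤ) ≤ α) :
    ContDiffOn ℝ ∞ (fun x => potV α r x) (configSpace n m) :=
  ContDiffOn.sum fun j _ => contDiffOn_vecP r j hα

lemma contDiffOn_tensorA (m : ℕ) (r k : Fin n) :
    ContDiffOn ℝ ∞ (fun x => tensorA m r x k k) (configSpace n m) := by
  simp only [tensorA, Matrix.diagonal_apply_eq]
  have := contDiffOn_zpow_div_Delta (m := m) k (k := (m : ℤ)) (by omega)
  simp only [zpow_natCast] at this
  exact (contDiffOn_pd_rho m k _).neg.mul this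

lemma contDiffOn_killingQ (m : ℕ) (r k : ℤ) (s : Set (Pt n)) :
    ContDiffOn ℝ ∞ (fun x => killingQ m r k x) s := by
  unfold killingQ
  have h (k : ℤ) : ContDiffOn ℝ ∞ (fun x : Pt n => rho k x) s := (contDiff_rho k).contDiffOn
  split_ifs
  · exact contDiffOn_const.mul (h _)
  · exact contDiffOn_const
  · exact (contDiffOn_const.mul (h _)).neg
  · exact contDiffOn_const
  · exact contDiffOn_const

lemma contDiffOn_killingJ (m : ℕ) (r j : Fin n) :
    ContDiffOn ℝ ∞ (fun x => killingJ m r x j) (configSpace n m) := by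
  refine (ContDiffOn.sum fun k _ => (contDiffOn_killingQ m _ _ _).mul
    (contDiffOn_zpow_div_Delta j ?_)).neg
  have := k.2
  simp only [idx]
  omega

lemma det_inv_metricG (m : ℕ) (x : Pt n) :
    ((metricG m x)⁻¹).det = (∏ i, (x i ^ m / Delta i x))⁻¹ := by
  rw [Matrix.det_nonsing_inv, metricG, Matrix.det_diagonal, Ring.inverse_eq_inv]

lemma prod_metric_ne_zero {m : ℕ} {x : Pt n} (hx : x ∈ configSpace n m) :
    ∏ i, (x i ^ m / Delta i x) ≠ 0 := by
  refine Finset.prod_ne_zero_iff.2 fun i _ => div_ne_zero ?_ (Delta_ne_zero hx.1 i)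
  by_cases hm : m = 0
  · simp [hm]
  · exact pow_ne_zero m (hx.2 hm i)

lemma vol_ne_zero {m : ℕ} {x : Pt n} (hx : x ∈ configSpace n m) : vol m x ≠ 0 := by
  rw [vol, det_inv_metricG]
  exact (Real.sqrt_pos.2 (abs_pos.2 (inv_ne_zero (prod_metric_ne_zero hx)))).ne'

lemma contDiffOn_vol (m : ℕ) : ContDiffOn ℝ ∞ (vol m : Pt n → ℝ) (configSpace n m) := by
  have h : ContDiffOn ℝ ∞ (fun x : Pt n => (∏ i, (x i ^ m / Delta i x))⁻¹) (configSpace n m) := by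
    refine (contDiffOn_prod fun i _ => ?_).inv fun x hx => prod_metric_ne_zero hx
    simpa only [zpow_natCast] using contDiffOn_zpow_div_Delta (m := m) i (k := (m : ℤ)) (by omega)
  unfold vol
  simp only [det_inv_metricG]
  exact (h.abs fun x hx => inv_ne_zero (prod_metric_ne_zero hx)).sqrt
    fun x hx => abs_ne_zero.2 (inv_ne_zero (prod_metric_ne_zero hx))

lemma contDiffOn_phaseGrad (m : ℕ) (a : ℤ → ℝ) (j : Fin n) :
    ContDiffOn ℝ ∞ (fun x => phaseGrad m a x j) (configSpace n m) :=
  ContDiffOn.sum fun _ hγ => contDiffOn_const.mul (contDiffOn_zpow_sub j (Finset.mem_Icc.1 hγ).1)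

lemma hasDerivAt_primPow {k : ℤ} {s : ℝ} (h : s ≠ 0 ∨ 0 ≤ k) :
    HasDerivAt (primPow k) (s ^ k) s := by
  unfold primPow
  split_ifs with hk
  · subst hk
    rw [zpow_neg_one]
    exact Real.hasDerivAt_log (h.resolve_right (by omega))
  · have h1 : ((k + 1 : ℤ) : ℝ) ≠ 0 := by
      rw [Int.cast_ne_zero]; omega
    have h2 := (hasDerivAt_zpow (k + 1) s (h.imp id fun h => by omega)).div_const ((k + 1 : ℤ) : ℝ)
    rwa [add_sub_cancel_right, mul_div_cancel_left₀ _ h1] at h2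

lemma contDiffOn_primPow {m : ℕ} (j : Fin n) {γ : ℤ} (hγ : 0 ≤ γ) :
    ContDiffOn ℝ ∞ (fun x : Pt n => primPow (γ - m) (x j)) (configSpace n m) := by
  unfold primPow
  split_ifs with hk
  -- The logarithm occurs only for `γ = m-1 ≥ 0`, hence `m ≥ 1`.
  · exact (contDiffOn_apply j _).log fun x hx => hx.2 (by omega) j
  · exact (contDiffOn_zpow j (by omega)).div_const _

lemma contDiffOn_phaseSum (m : ℕ) (a : ℤ → ℝ) :
    ContDiffOn ℝ ∞ (phaseSum m a : Pt n → ℝ) (configSpace n m) :=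
  ContDiffOn.sum fun _ hγ => contDiffOn_const.mul
    (ContDiffOn.sum fun j _ => contDiffOn_primPow j (Finset.mem_Icc.1 hγ).1)

lemma pd_apply_comp {f : ℝ → ℝ} {f' : ℝ} (j k : Fin n) {x : Pt n} (hf : HasDerivAt f f' (x j)) :
    pd k (fun y : Pt n => f (y j)) x = if j = k then f' else 0 := by
  have hp : HasFDerivAt (fun y : Pt n => y j)
      (ContinuousLinearMap.proj (R := ℝ) (φ := fun _ : Fin n => ℝ) j) x := hasFDerivAt_apply j x
  have h : HasFDerivAt (fun y : Pt n => f (y j))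
      (f' • ContinuousLinearMap.proj (R := ℝ) (φ := fun _ : Fin n => ℝ) j) x :=
    HasDerivAt.comp_hasFDerivAt (f := fun y : Pt n => y j) x hf hp
  rw [pd, h.fderiv]
  simp [Pi.single_apply]

lemma pd_phaseSum {m : ℕ} (a : ℤ → ℝ) (k : Fin n) {x : Pt n} (hx : x ∈ configSpace n m) :
    pd k (phaseSum m a) x = phaseGrad m a x k := by
  have ho := isOpen_configSpace n m
  have hd : ∀ γ ∈ Finset.Icc (0 : ℤ) (n + 1), ∀ j : Fin n,
      DifferentiableAt ℝ (fun y : Pt n => primPow (γ - m) (y j)) x := fun γ hγ j =>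
    differentiableAt_of_contDiffOn ho (contDiffOn_primPow j (Finset.mem_Icc.1 hγ).1) hx
  have hd' : ∀ γ ∈ Finset.Icc (0 : ℤ) (n + 1),
      DifferentiableAt ℝ (fun y : Pt n => ∑ j, primPow (γ - m) (y j)) x := fun γ hγ =>
    DifferentiableAt.fun_sum fun j _ => hd γ hγ j
  unfold phaseSum phaseGrad
  rw [pd_sum _ _ fun γ hγ => (hd' γ hγ).const_mul _]
  refine Finset.sum_congr rfl fun γ hγ => ?_
  rw [pd_const_mul _ _ (hd' γ hγ), pd_sum _ _ fun j _ => hd γ hγ j]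
  congr 1
  rw [Finset.sum_congr rfl fun j _ => pd_apply_comp j k (hasDerivAt_primPow (k := γ - m) ?_)]
  · simp
  · by_cases hm : m = 0
    · right; rw [Finset.mem_Icc] at hγ; omega
    · exact Or.inl (hx.2 hm j)

/-! ### Minimal quantizations as differential operators -/

/-- Smooth complex functions on the configuration space. -/
abbrev SmoothOn (m : ℕ) (ψ : Pt n → ℂ) : Prop := ContDiffOn ℝ ∞ ψ (configSpace n m)

lemma SmoothOn.pd {m : ℕ} {ψ : Pt n → ℂ} (hψ : SmoothOn m ψ) (k : Fin n) :
    SmoothOn m (pd k ψ) :=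
  contDiffOn_pd (isOpen_configSpace n m) hψ k

lemma SmoothOn.diff {m : ℕ} {ψ : Pt n → ℂ} (hψ : SmoothOn m ψ) {x : Pt n}
    (hx : x ∈ configSpace n m) : DifferentiableAt ℝ ψ x :=
  differentiableAt_of_contDiffOn (isOpen_configSpace n m) hψ hx

lemma smoothOn_vol (m : ℕ) : SmoothOn m (fun y : Pt n => ((vol m y : ℝ) : ℂ)) :=
  contDiffOn_ofReal (contDiffOn_vol m)

lemma smoothOn_tensorA (m : ℕ) (r k : Fin n) :
    SmoothOn m (fun y : Pt n => ((tensorA m r y k k : ℝ) : ℂ)) :=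
  contDiffOn_ofReal (contDiffOn_tensorA m r k)

/-- A vector field with smooth components on the configuration space. -/
abbrev SmoothField (m : ℕ) (X : Pt n → Fin n → ℝ) : Prop :=
  ∀ j, ContDiffOn ℝ ∞ (fun y => X y j) (configSpace n m)

lemma SmoothField.ofReal {m : ℕ} {X : Pt n → Fin n → ℝ} (hX : SmoothField m X) (j : Fin n) :
    SmoothOn m (fun y => ((X y j : ℝ) : ℂ)) :=
  contDiffOn_ofReal (hX j)

lemma quantQuad_tensorA (hbar : ℝ) (m : ℕ) (r : Fin n) (ψ : Pt n → ℂ) (x : Pt n) :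
    quantQuad hbar m (tensorA m r) ψ x =
      -(1 / 2 : ℂ) * (hbar : ℂ) ^ 2 * ((vol m x : ℝ) : ℂ)⁻¹ *
        ∑ k, pd k (fun y => ((vol m y : ℝ) : ℂ) * ((tensorA m r y k k : ℝ) : ℂ) * pd k ψ y) x := by
  unfold quantQuad
  congr 1
  refine Finset.sum_congr rfl fun k _ => ?_
  congr 1
  funext y
  rw [Finset.sum_eq_single_of_mem k (Finset.mem_univ k), mul_assoc]
  intro j _ hj
  rw [tensorA, Matrix.diagonal_apply_ne' _ hj, Complex.ofReal_zero, zero_mul]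

lemma quantLin_eq (hbar : ℝ) {m : ℕ} {X : Pt n → Fin n → ℝ} (hX : SmoothField m X)
    {ψ : Pt n → ℂ} (hψ : SmoothOn m ψ) {x : Pt n} (hx : x ∈ configSpace n m) :
    quantLin hbar m X ψ x =
      -(1 / 2 : ℂ) * Complex.I * (hbar : ℂ) * (((vol m x : ℝ) : ℂ)⁻¹ *
        ∑ j, pd j (fun y => ((vol m y : ℝ) : ℂ) * ((X y j : ℝ) : ℂ)) x * ψ x +
        2 * ∑ j, ((X x j : ℝ) : ℂ) * pd j ψ x) := by
  have hv : ((vol m x : ℝ) : ℂ) ≠ 0 := Complex.ofReal_ne_zero.2 (vol_ne_zero hx)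
  unfold quantLin
  congr 1
  rw [two_mul, ← add_assoc]
  congr 1
  simp only [Finset.mul_sum]
  rw [← Finset.sum_add_distrib]
  refine Finset.sum_congr rfl fun j _ => ?_
  rw [pd_mul j (SmoothOn.diff ((smoothOn_vol m).mul (hX.ofReal j)) hx) (hψ.diff hx)]
  field_simp

/-- By `quantLin_eq` the operator is a derivation plus a divergence of order zero; the latter
commutes with `f`. -/
lemma quantLin_mul (hbar : ℝ) {m : ℕ} {X : Pt n → Fin n → ℝ} (hX : SmoothField m X)
    {f ψ : Pt n → ℂ} (hf : SmoothOn m f) (hψ : SmoothOn m ψ) {x : Pt n}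
    (hx : x ∈ configSpace n m) :
    quantLin hbar m X (fun y => f y * ψ y) x = f x * quantLin hbar m X ψ x -
      Complex.I * (hbar : ℂ) * (∑ j, ((X x j : ℝ) : ℂ) * pd j f x) * ψ x := by
  rw [quantLin_eq hbar hX (hf.mul hψ) hx, quantLin_eq hbar hX hψ hx]
  have h1 : ∑ j, ((X x j : ℝ) : ℂ) * pd j (fun y => f y * ψ y) x =
      (∑ j, ((X x j : ℝ) : ℂ) * pd j f x) * ψ x + f x * ∑ j, ((X x j : ℝ) : ℂ) * pd j ψ x := by
    rw [Finset.sum_mul, Finset.mul_sum, ← Finset.sum_add_distrib]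
    refine Finset.sum_congr rfl fun j _ => ?_
    rw [pd_mul j (hf.diff hx) (hψ.diff hx)]
    ring
  rw [h1, ← Finset.sum_mul, ← Finset.sum_mul]
  ring

lemma quantQuad_mul (hbar : ℝ) (m : ℕ) (r : Fin n) {f ψ : Pt n → ℂ} (hf : SmoothOn m f)
    (hψ : SmoothOn m ψ) {x : Pt n} (hx : x ∈ configSpace n m) :
    quantQuad hbar m (tensorA m r) (fun y => f y * ψ y) x =
      f x * quantQuad hbar m (tensorA m r) ψ x -
      (1 / 2 : ℂ) * (hbar : ℂ) ^ 2 * (((vol m x : ℝ) : ℂ)⁻¹ *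
        ∑ k, pd k (fun y => ((vol m y : ℝ) : ℂ) * ((tensorA m r y k k : ℝ) : ℂ) * pd k f y) x
          * ψ x +
        2 * ∑ k, ((tensorA m r x k k : ℝ) : ℂ) * pd k f x * pd k ψ x) := by
  have ho := isOpen_configSpace n m
  have hv : ((vol m x : ℝ) : ℂ) ≠ 0 := Complex.ofReal_ne_zero.2 (vol_ne_zero hx)
  -- Leibniz rule for a divergence-form operator: the two cross terms coincide because the tensor is
  -- diagonal, whence the factor 2.
  have key : ∀ k : Fin n,
      pd k (fun y => ((vol m y : ℝ) : ℂ) * ((tensorA m r y k k : ℝ) : ℂ) *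
        pd k (fun z => f z * ψ z) y) x =
      f x * pd k (fun y => ((vol m y : ℝ) : ℂ) * ((tensorA m r y k k : ℝ) : ℂ) * pd k ψ y) x +
      (pd k (fun y => ((vol m y : ℝ) : ℂ) * ((tensorA m r y k k : ℝ) : ℂ) * pd k f y) x * ψ x +
        2 * (((vol m x : ℝ) : ℂ) * (((tensorA m r x k k : ℝ) : ℂ) * pd k f x * pd k ψ x))) := by
    intro k
    have hva := (smoothOn_vol m).mul (smoothOn_tensorA m r k)
    have e : ∀ y ∈ configSpace n m,
        ((vol m y : ℝ) : ℂ) * ((tensorA m r y k k : ℝ) : ℂ) * pd k (fun z => f z * ψ z) y =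
        (((vol m y : ℝ) : ℂ) * ((tensorA m r y k k : ℝ) : ℂ) * pd k f y) * ψ y +
        f y * (((vol m y : ℝ) : ℂ) * ((tensorA m r y k k : ℝ) : ℂ) * pd k ψ y) := by
      intro y hy
      rw [pd_mul k (hf.diff hy) (hψ.diff hy)]
      ring
    have hF : SmoothOn m
        (fun y => ((vol m y : ℝ) : ℂ) * ((tensorA m r y k k : ℝ) : ℂ) * pd k f y) :=
      hva.mul (hf.pd k)
    have hP : SmoothOn m
        (fun y => ((vol m y : ℝ) : ℂ) * ((tensorA m r y k k : ℝ) : ℂ) * pd k ψ y) :=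
      hva.mul (hψ.pd k)
    rw [pd_congr_of_isOpen ho e k hx, pd_add k (SmoothOn.diff (hF.mul hψ) hx)
      (SmoothOn.diff (hf.mul hP) hx),
      pd_mul k (hF.diff hx) (hψ.diff hx), pd_mul k (hf.diff hx) (hP.diff hx)]
    ring
  rw [quantQuad_tensorA, quantQuad_tensorA, Finset.sum_congr rfl fun k _ => key k,
    Finset.sum_add_distrib, Finset.sum_add_distrib, ← Finset.mul_sum, ← Finset.mul_sum,
    ← Finset.mul_sum]
  have hfin : ∀ F S₁ S₂ S₃ : ℂ,
      -(1 / 2 : ℂ) * (hbar : ℂ) ^ 2 * ((vol m x : ℝ) : ℂ)⁻¹ *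
        (F * S₁ + (S₂ + 2 * (((vol m x : ℝ) : ℂ) * S₃))) =
      F * (-(1 / 2 : ℂ) * (hbar : ℂ) ^ 2 * ((vol m x : ℝ) : ℂ)⁻¹ * S₁) -
        (1 / 2 : ℂ) * (hbar : ℂ) ^ 2 * (((vol m x : ℝ) : ℂ)⁻¹ * S₂ + 2 * S₃) := by
    intro F S₁ S₂ S₃
    field_simp
    ring
  exact hfin _ _ _ _

/-- The quantization of the vector field `∑ a_γ P_r^{(γ)}`. -/
lemma quantLin_sum_vecP (hbar : ℝ) {m : ℕ} (a : ℤ → ℝ) (r : Fin n)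
    {ψ : Pt n → ℂ} (hψ : SmoothOn m ψ) {x : Pt n} (hx : x ∈ configSpace n m) :
    quantLin hbar m (fun y j => ∑ γ ∈ Finset.Icc (0 : ℤ) (n + 1), a γ * vecP γ r y j) ψ x =
      ∑ γ ∈ Finset.Icc (0 : ℤ) (n + 1), ((a γ : ℝ) : ℂ) * quantLin hbar m (vecP γ r) ψ x := by
  have hP : ∀ γ ∈ Finset.Icc (0 : ℤ) (n + 1), SmoothField m (vecP γ r : Pt n → Fin n → ℝ) :=
    fun γ hγ j => contDiffOn_vecP r j (by rw [Finset.mem_Icc] at hγ; omega)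
  have hS : SmoothField m
      (fun (y : Pt n) j => ∑ γ ∈ Finset.Icc (0 : ℤ) (n + 1), a γ * vecP γ r y j) :=
    fun j => ContDiffOn.sum fun γ hγ => contDiffOn_const.mul (hP γ hγ j)
  have h0 : ∀ γ ∈ Finset.Icc (0 : ℤ) (n + 1), ((a γ : ℝ) : ℂ) * quantLin hbar m (vecP γ r) ψ x =
      -(1 / 2 : ℂ) * Complex.I * (hbar : ℂ) * (((a γ : ℝ) : ℂ) * (((vol m x : ℝ) : ℂ)⁻¹ *
        ∑ j, pd j (fun y => ((vol m y : ℝ) : ℂ) * ((vecP γ r y j : ℝ) : ℂ)) x * ψ x +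
        2 * ∑ j, ((vecP γ r x j : ℝ) : ℂ) * pd j ψ x)) := by
    intro γ hγ
    rw [quantLin_eq hbar (hP γ hγ) hψ hx]
    ring
  rw [quantLin_eq hbar hS hψ hx, Finset.sum_congr rfl h0, ← Finset.mul_sum]
  congr 1
  have h1 : ∀ j : Fin n, pd j (fun y => ((vol m y : ℝ) : ℂ) *
      ((∑ γ ∈ Finset.Icc (0 : ℤ) (n + 1), a γ * vecP γ r y j : ℝ) : ℂ)) x =
      ∑ γ ∈ Finset.Icc (0 : ℤ) (n + 1), ((a γ : ℝ) : ℂ) *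
        pd j (fun y => ((vol m y : ℝ) : ℂ) * ((vecP γ r y j : ℝ) : ℂ)) x := by
    intro j
    have hd : ∀ γ ∈ Finset.Icc (0 : ℤ) (n + 1),
        DifferentiableAt ℝ (fun y => ((vol m y : ℝ) : ℂ) * ((vecP γ r y j : ℝ) : ℂ)) x :=
      fun γ hγ => SmoothOn.diff ((smoothOn_vol m).mul ((hP γ hγ).ofReal j)) hx
    rw [Finset.sum_congr rfl fun γ hγ => (pd_const_mul ((a γ : ℝ) : ℂ) j (hd γ hγ)).symm,
      ← pd_sum _ _ fun γ hγ => (hd γ hγ).const_mul _]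
    congr 1
    funext y
    push_cast
    rw [Finset.mul_sum]
    exact Finset.sum_congr rfl fun γ _ => by ring
  simp only [h1]
  push_cast
  simp only [Finset.mul_sum, Finset.sum_mul, mul_add, Finset.sum_add_distrib]
  congr 1
  · rw [Finset.sum_comm]
    exact Finset.sum_congr rfl fun γ _ => Finset.sum_congr rfl fun j _ => by ring
  · rw [Finset.sum_comm]
    exact Finset.sum_congr rfl fun γ _ => Finset.sum_congr rfl fun j _ => by ring

/-! ### Phases: commutators and conjugation -/

/-- The factor `λ_k^m` of the tensor turns `λ_k^(γ-m)` into `λ_k^γ`. This is why the magnetic terms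
can be gauged away. -/
lemma tensorA_mul_phaseGrad {m : ℕ} (a : ℤ → ℝ) (r k : Fin n) {x : Pt n}
    (hx : x ∈ configSpace n m) :
    tensorA m r x k k * phaseGrad m a x k =
      -∑ γ ∈ Finset.Icc (0 : ℤ) (n + 1), a γ * vecP γ r x k := by
  simp only [tensorA, Matrix.diagonal_apply_eq, phaseGrad, vecP]
  rw [Finset.mul_sum, ← Finset.sum_neg_distrib]
  refine Finset.sum_congr rfl fun γ hγ => ?_
  have := zpow_mul_zpow_sub (m := m) (fun h => hx.2 h k) (p := m) (by omega) (Finset.mem_Icc.1 hγ).1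
  have e : (m : ℤ) + γ - m = γ := by ring
  rw [e, zpow_natCast] at this
  rw [← this]
  ring

lemma sum_vecP_mul_phaseGrad {m : ℕ} (a : ℤ → ℝ) (r : Fin n) {γ : ℤ} (hγ : 0 ≤ γ) {x : Pt n}
    (hx : x ∈ configSpace n m) :
    ∑ k, vecP γ r x k * phaseGrad m a x k =
      ∑ γ' ∈ Finset.Icc (0 : ℤ) (n + 1), a γ' * potV (γ + γ' - m) r x := by
  simp only [phaseGrad, potV, Finset.mul_sum]
  rw [Finset.sum_comm]
  refine Finset.sum_congr rfl fun γ' hγ' => Finset.sum_congr rfl fun k _ => ?_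
  rw [← zpow_mul_zpow_sub (fun h => hx.2 h k) hγ (Finset.mem_Icc.1 hγ').1, vecP]
  ring

lemma smoothField_killingJ (m : ℕ) (r : Fin n) :
    SmoothField m (killingJ m r : Pt n → Fin n → ℝ) :=
  contDiffOn_killingJ m r

lemma smoothField_vecP (m : ℕ) (r : Fin n) {γ : ℤ} (hγ : 0 ≤ γ) :
    SmoothField m (vecP γ r : Pt n → Fin n → ℝ) :=
  fun j => contDiffOn_vecP r j (by omega)

lemma smoothOn_phaseSum (m : ℕ) (a : ℤ → ℝ) :
    SmoothOn m (fun y : Pt n => ((phaseSum m a y : ℝ) : ℂ)) :=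
  contDiffOn_ofReal (contDiffOn_phaseSum m a)

lemma pd_ofReal_phaseSum {m : ℕ} (a : ℤ → ℝ) (k : Fin n) {x : Pt n}
    (hx : x ∈ configSpace n m) :
    pd k (fun y => ((phaseSum m a y : ℝ) : ℂ)) x = ((phaseGrad m a x k : ℝ) : ℂ) := by
  rw [pd_ofReal k (differentiableAt_of_contDiffOn (isOpen_configSpace n m)
    (contDiffOn_phaseSum m a) hx), pd_phaseSum a k hx]

lemma smoothField_sum_vecP (m : ℕ) (a : ℤ → ℝ) (r : Fin n) :
    SmoothField m (fun (y : Pt n) j => ∑ γ ∈ Finset.Icc (0 : ℤ) (n + 1), a γ * vecP γ r y j) :=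
  fun j => ContDiffOn.sum fun _ hγ =>
    contDiffOn_const.mul (smoothField_vecP m r (Finset.mem_Icc.1 hγ).1 j)

/-- The commutator of the geodesic operator with a phase. -/
lemma geodesicOp_phaseSum_mul (hbar : ℝ) {m : ℕ} (a : ℤ → ℝ) (r : Fin n)
    {ψ : Pt n → ℂ} (hψ : SmoothOn m ψ) {x : Pt n} (hx : x ∈ configSpace n m) :
    geodesicOp hbar m r (fun y => ((phaseSum m a y : ℝ) : ℂ) * ψ y) x =
      ((phaseSum m a x : ℝ) : ℂ) * geodesicOp hbar m r ψ x +
      Complex.I * (hbar : ℂ) *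
        ((∑ γ ∈ Finset.Icc (0 : ℤ) (n + 1), ((a γ : ℝ) : ℂ) * quantLin hbar m (vecP γ r) ψ x) -
        ((∑ j, killingJ m r x j * phaseGrad m a x j : ℝ) : ℂ) * ψ x) := by
  have ho := isOpen_configSpace n m
  unfold geodesicOp
  rw [quantQuad_mul hbar m r (smoothOn_phaseSum m a) hψ hx,
    quantLin_mul hbar (smoothField_killingJ m r) (smoothOn_phaseSum m a) hψ hx,
    ← quantLin_sum_vecP hbar a r hψ hx, quantLin_eq hbar (smoothField_sum_vecP m a r) hψ hx]
  have h1 : ∀ k : Fin n, ∀ y ∈ configSpace n m,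
      ((tensorA m r y k k : ℝ) : ℂ) * pd k (fun z => ((phaseSum m a z : ℝ) : ℂ)) y =
      -((∑ γ ∈ Finset.Icc (0 : ℤ) (n + 1), a γ * vecP γ r y k : ℝ) : ℂ) := by
    intro k y hy
    rw [pd_ofReal_phaseSum a k hy, ← Complex.ofReal_mul, tensorA_mul_phaseGrad a r k hy,
      Complex.ofReal_neg]
  have h2 : ∀ k : Fin n, pd k (fun y => ((vol m y : ℝ) : ℂ) * ((tensorA m r y k k : ℝ) : ℂ) *
      pd k (fun z => ((phaseSum m a z : ℝ) : ℂ)) y) x =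
      -pd k (fun y => ((vol m y : ℝ) : ℂ) *
        ((∑ γ ∈ Finset.Icc (0 : ℤ) (n + 1), a γ * vecP γ r y k : ℝ) : ℂ)) x := by
    intro k
    rw [← neg_one_mul, ← pd_const_mul (-1 : ℂ) k
      (SmoothOn.diff ((smoothOn_vol m).mul ((smoothField_sum_vecP m a r).ofReal k)) hx)]
    -- The pointwise identity `h1` may be differentiated because it holds on an open set.
    refine pd_congr_of_isOpen ho (fun y hy => ?_) k hx
    rw [mul_assoc, h1 k y hy]
    ring
  have h3 : ∑ j, ((killingJ m r x j : ℝ) : ℂ) * pd j (fun z => ((phaseSum m a z : ℝ) : ℂ)) x =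
      ((∑ j, killingJ m r x j * phaseGrad m a x j : ℝ) : ℂ) := by
    push_cast
    exact Finset.sum_congr rfl fun j _ => by rw [pd_ofReal_phaseSum a j hx]
  rw [h3]
  simp only [h2, h1 _ x hx, neg_mul, Finset.sum_neg_distrib]
  have hfin : ∀ F Q L V S₁ S₂ K Ψ : ℂ,
      F * Q - (1 / 2 : ℂ) * (hbar : ℂ) ^ 2 * (V * -S₁ + 2 * -S₂) +
        (F * L - Complex.I * (hbar : ℂ) * K * Ψ) =
      F * (Q + L) + Complex.I * (hbar : ℂ) *
        (-(1 / 2 * Complex.I * (hbar : ℂ) * (V * S₁ + 2 * S₂)) - K * Ψ) := by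
    intro F Q L V S₁ S₂ K Ψ
    linear_combination (1 / 2 : ℂ) * (hbar : ℂ) ^ 2 * (V * S₁ + 2 * S₂) * Complex.I_sq
  exact hfin _ _ _ _ _ _ _ _

/-- The inverse gauge factor `exp (i W / ħ)` of the phase `W`. -/
def phaseExp (hbar : ℝ) (m : ℕ) (a : ℤ → ℝ) (x : Pt n) : ℂ :=
  Complex.exp (Complex.I / (hbar : ℂ) * ((phaseSum m a x : ℝ) : ℂ))

lemma smoothOn_phaseExp (hbar : ℝ) (m : ℕ) (a : ℤ → ℝ) :
    SmoothOn m (phaseExp hbar m a : Pt n → ℂ) :=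
  (contDiffOn_const.mul (smoothOn_phaseSum m a)).cexp

lemma pd_phaseExp (hbar : ℝ) {m : ℕ} (a : ℤ → ℝ) (k : Fin n) {x : Pt n}
    (hx : x ∈ configSpace n m) :
    pd k (phaseExp hbar m a) x =
      Complex.I / (hbar : ℂ) * ((phaseGrad m a x k : ℝ) : ℂ) * phaseExp hbar m a x := by
  unfold phaseExp
  rw [pd_cexp k (((smoothOn_phaseSum m a).diff hx).const_mul _),
    pd_const_mul _ _ ((smoothOn_phaseSum m a).diff hx), pd_ofReal_phaseSum a k hx, mul_comm]

/-- Conjugation of a quantized vector field by the gauge factor. -/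
lemma quantLin_phaseExp_mul {hbar : ℝ} (hh : hbar ≠ 0) {m : ℕ} (a : ℤ → ℝ)
    {X : Pt n → Fin n → ℝ} (hX : SmoothField m X)
    {ψ : Pt n → ℂ} (hψ : SmoothOn m ψ) {x : Pt n} (hx : x ∈ configSpace n m) :
    quantLin hbar m X (fun y => phaseExp hbar m a y * ψ y) x =
      phaseExp hbar m a x * (quantLin hbar m X ψ x +
        ((∑ j, X x j * phaseGrad m a x j : ℝ) : ℂ) * ψ x) := by
  have hh' : (hbar : ℂ) ≠ 0 := Complex.ofReal_ne_zero.2 hh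
  rw [quantLin_mul hbar hX (smoothOn_phaseExp hbar m a) hψ hx]
  have h : ∑ j, ((X x j : ℝ) : ℂ) * pd j (phaseExp hbar m a) x =
      Complex.I / (hbar : ℂ) * phaseExp hbar m a x *
        ((∑ j, X x j * phaseGrad m a x j : ℝ) : ℂ) := by
    push_cast
    rw [Finset.mul_sum]
    exact Finset.sum_congr rfl fun j _ => by rw [pd_phaseExp hbar a j hx]; ring
  rw [h]
  field_simp
  rw [Complex.I_sq]
  ring

/-- Conjugation of the quantized geodesic Hamiltonian by the gauge factor. -/
lemma quantQuad_phaseExp_mul {hbar : ℝ} (hh : hbar ≠ 0) {m : ℕ} (a : ℤ → ℝ) (r : Fin n)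
    {ψ : Pt n → ℂ} (hψ : SmoothOn m ψ) {x : Pt n} (hx : x ∈ configSpace n m) :
    quantQuad hbar m (tensorA m r) (fun y => phaseExp hbar m a y * ψ y) x =
      phaseExp hbar m a x * (quantQuad hbar m (tensorA m r) ψ x -
        ∑ γ ∈ Finset.Icc (0 : ℤ) (n + 1), ((a γ : ℝ) : ℂ) * quantLin hbar m (vecP γ r) ψ x -
        (1 / 2 : ℂ) * ((∑ γ ∈ Finset.Icc (0 : ℤ) (n + 1), ∑ γ' ∈ Finset.Icc (0 : ℤ) (n + 1),
          a γ * a γ' * potV (γ + γ' - m) r x : ℝ) : ℂ) * ψ x) := by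
  have ho := isOpen_configSpace n m
  have hh' : (hbar : ℂ) ≠ 0 := Complex.ofReal_ne_zero.2 hh
  have hv : ((vol m x : ℝ) : ℂ) ≠ 0 := Complex.ofReal_ne_zero.2 (vol_ne_zero hx)
  set X : Pt n → Fin n → ℝ :=
    fun y j => ∑ γ ∈ Finset.Icc (0 : ℤ) (n + 1), a γ * vecP γ r y j with hXdef
  have hX : SmoothField m X := smoothField_sum_vecP m a r
  have hU := smoothOn_phaseExp (n := n) hbar m a
  have h1 : ∀ k : Fin n, ∀ y ∈ configSpace n m,
      ((tensorA m r y k k : ℝ) : ℂ) * pd k (phaseExp hbar m a) y =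
      -(Complex.I / (hbar : ℂ)) * (((X y k : ℝ) : ℂ) * phaseExp hbar m a y) := by
    intro k y hy
    have := congrArg (fun s : ℝ => (s : ℂ)) (tensorA_mul_phaseGrad a r k hy)
    simp only [Complex.ofReal_mul, Complex.ofReal_neg] at this
    rw [pd_phaseExp hbar a k hy]
    linear_combination Complex.I / (hbar : ℂ) * phaseExp hbar m a y * this
  have h2 : ∀ k : Fin n, pd k (fun y => ((vol m y : ℝ) : ℂ) * ((tensorA m r y k k : ℝ) : ℂ) *
      pd k (phaseExp hbar m a) y) x =
      -(Complex.I / (hbar : ℂ)) * phaseExp hbar m a x *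
        (pd k (fun y => ((vol m y : ℝ) : ℂ) * ((X y k : ℝ) : ℂ)) x +
          Complex.I / (hbar : ℂ) * ((vol m x : ℝ) : ℂ) *
            (((X x k : ℝ) : ℂ) * ((phaseGrad m a x k : ℝ) : ℂ))) := by
    intro k
    have hvX : SmoothOn m (fun y => ((vol m y : ℝ) : ℂ) * ((X y k : ℝ) : ℂ)) :=
      (smoothOn_vol m).mul (hX.ofReal k)
    have e : ∀ y ∈ configSpace n m,
        ((vol m y : ℝ) : ℂ) * ((tensorA m r y k k : ℝ) : ℂ) * pd k (phaseExp hbar m a) y =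
        -(Complex.I / (hbar : ℂ)) *
          ((((vol m y : ℝ) : ℂ) * ((X y k : ℝ) : ℂ)) * phaseExp hbar m a y) := by
      intro y hy
      rw [mul_assoc, h1 k y hy]
      ring
    rw [pd_congr_of_isOpen ho e k hx, pd_const_mul _ _ (SmoothOn.diff (hvX.mul hU) hx),
      pd_mul k (hvX.diff hx) (hU.diff hx), pd_phaseExp hbar a k hx]
    ring
  -- The double sum of potentials is the pairing of the magnetic field `X` with the gradient of the
  -- phase, that is, minus the quadratic form of the tensor on that gradient.
  have h3 : ((∑ γ ∈ Finset.Icc (0 : ℤ) (n + 1), ∑ γ' ∈ Finset.Icc (0 : ℤ) (n + 1),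
      a γ * a γ' * potV (γ + γ' - m) r x : ℝ) : ℂ) =
      ∑ k, ((X x k : ℝ) : ℂ) * ((phaseGrad m a x k : ℝ) : ℂ) := by
    rw [Finset.sum_congr rfl fun k _ => (Complex.ofReal_mul _ _).symm, ← Complex.ofReal_sum]
    congr 1
    simp only [hXdef, Finset.sum_mul]
    rw [Finset.sum_comm (s := Finset.univ)]
    refine Finset.sum_congr rfl fun γ hγ => ?_
    simp only [mul_assoc]
    rw [← Finset.mul_sum, ← Finset.mul_sum,
      sum_vecP_mul_phaseGrad a r (Finset.mem_Icc.1 hγ).1 hx]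
  rw [quantQuad_mul hbar m r hU hψ hx, ← quantLin_sum_vecP hbar a r hψ hx,
    quantLin_eq hbar hX hψ hx, h3]
  simp only [h2, h1 _ x hx]
  have h4 : ∑ k, -(Complex.I / (hbar : ℂ)) * phaseExp hbar m a x *
        (pd k (fun y => ((vol m y : ℝ) : ℂ) * ((X y k : ℝ) : ℂ)) x +
          Complex.I / (hbar : ℂ) * ((vol m x : ℝ) : ℂ) *
            (((X x k : ℝ) : ℂ) * ((phaseGrad m a x k : ℝ) : ℂ))) * ψ x =
      -(Complex.I / (hbar : ℂ)) * phaseExp hbar m a x *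
        (∑ k, pd k (fun y => ((vol m y : ℝ) : ℂ) * ((X y k : ℝ) : ℂ)) x * ψ x +
          Complex.I / (hbar : ℂ) * ((vol m x : ℝ) : ℂ) *
            (∑ k, ((X x k : ℝ) : ℂ) * ((phaseGrad m a x k : ℝ) : ℂ)) * ψ x) := by
    simp only [Finset.mul_sum, Finset.sum_mul]
    rw [← Finset.sum_add_distrib, Finset.mul_sum]
    exact Finset.sum_congr rfl fun k _ => by ring
  have h5 : ∑ k, -(Complex.I / (hbar : ℂ)) * (((X x k : ℝ) : ℂ) * phaseExp hbar m a x) *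
      pd k ψ x = -(Complex.I / (hbar : ℂ)) * phaseExp hbar m a x *
        ∑ k, ((X x k : ℝ) : ℂ) * pd k ψ x := by
    rw [Finset.mul_sum]
    exact Finset.sum_congr rfl fun k _ => by ring
  rw [h4, h5]
  have hfin : ∀ E Q S₁ S₂ S₃ Ψ : ℂ,
      E * Q - (1 / 2 : ℂ) * (hbar : ℂ) ^ 2 * (((vol m x : ℝ) : ℂ)⁻¹ *
        (-(Complex.I / (hbar : ℂ)) * E *
          (S₁ + Complex.I / (hbar : ℂ) * ((vol m x : ℝ) : ℂ) * S₃ * Ψ)) +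
        2 * (-(Complex.I / (hbar : ℂ)) * E * S₂)) =
      E * (Q - -(1 / 2 : ℂ) * Complex.I * (hbar : ℂ) *
        (((vol m x : ℝ) : ℂ)⁻¹ * S₁ + 2 * S₂) - 1 / 2 * S₃ * Ψ) := by
    intro E Q S₁ S₂ S₃ Ψ
    field_simp
    linear_combination E * S₃ * Ψ * ((vol m x : ℝ) : ℂ) * Complex.I_sq
  exact hfin _ _ _ _ _ _

/-! ### The gauge transformation of the operators -/

/-- Since the phase is real, complex conjugation only reverses the sign of `i`. -/
lemma gaugeUdag_eq_phaseExp (hbar : ℝ) (m : ℕ) (d : ℤ → Pt n → ℝ) (t x : Pt n) :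
    gaugeUdag hbar m d t x = phaseExp hbar m (fun γ => d γ t) x := by
  rw [gaugeUdag, gaugeU, phaseExp, ← Complex.exp_conj, phaseF]
  congr 1
  rw [map_mul, Complex.conj_ofReal, map_neg, map_div₀, Complex.conj_I, Complex.conj_ofReal,
    phaseSum]
  ring

lemma gaugeU_mul_gaugeUdag (hbar : ℝ) (m : ℕ) (d : ℤ → Pt n → ℝ) (t x : Pt n) :
    gaugeU hbar m d t x * gaugeUdag hbar m d t x = 1 := by
  rw [gaugeUdag_eq_phaseExp, gaugeU, phaseExp, ← Complex.exp_add, ← Complex.exp_zero]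
  congr 1
  rw [phaseF, phaseSum]
  ring

lemma smoothOn_gaugeUdag (hbar : ℝ) (m : ℕ) (d : ℤ → Pt n → ℝ) (t : Pt n) :
    SmoothOn m (fun x => gaugeUdag hbar m d t x) := by
  simp only [gaugeUdag_eq_phaseExp]
  exact smoothOn_phaseExp hbar m _

lemma smoothOn_gaugeU (hbar : ℝ) (m : ℕ) (d : ℤ → Pt n → ℝ) (t : Pt n) :
    SmoothOn m (fun x => gaugeU hbar m d t x) :=
  (contDiffOn_const.mul (smoothOn_phaseSum m (fun γ => d γ t))).cexp

/-- The conjugated kinetic term contributes `-∑ d_γ M̂^(γ)` and `-½` of the quadratic form; the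
conjugated magnetic terms contribute `+∑ d_γ M̂^(γ)` and the whole form. The net result is `+½` and
no magnetic operator. -/
lemma hB_gaugeUdag_mul [NeZero n] {hbar : ℝ} (hh : hbar ≠ 0) {m : ℕ} (d : ℤ → Pt n → ℝ)
    (bbar : ℝ) (e : ℤ → Pt n → ℝ) (r : Fin n) (t : Pt n) {ψ : Pt n → ℂ} (hψ : SmoothOn m ψ)
    {x : Pt n} (hx : x ∈ configSpace n m) :
    hB hbar m d bbar e r t (fun y => gaugeUdag hbar m d t y * ψ y) x =
      gaugeUdag hbar m d t x *
        (geodesicOp hbar m r ψ x + ((scalarB m d bbar e r t x : ℝ) : ℂ) * ψ x) := by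
  unfold hB geodesicOp
  simp only [gaugeUdag_eq_phaseExp]
  have h1 : ∀ γ ∈ Finset.Icc (0 : ℤ) (n + 1), ((d γ t : ℝ) : ℂ) *
      quantLin hbar m (vecP γ r) (fun y => phaseExp hbar m (fun γ => d γ t) y * ψ y) x =
      phaseExp hbar m (fun γ => d γ t) x * (((d γ t : ℝ) : ℂ) * quantLin hbar m (vecP γ r) ψ x +
        ((∑ γ' ∈ Finset.Icc (0 : ℤ) (n + 1), d γ t * d γ' t * potV (γ + γ' - m) r x : ℝ) : ℂ) *
          ψ x) := by
    intro γ hγ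
    rw [quantLin_phaseExp_mul hh _ (smoothField_vecP m r (Finset.mem_Icc.1 hγ).1) hψ hx,
      sum_vecP_mul_phaseGrad _ r (Finset.mem_Icc.1 hγ).1 hx]
    simp only [mul_assoc]
    rw [← Finset.mul_sum]
    push_cast
    ring
  rw [quantQuad_phaseExp_mul hh _ r hψ hx,
    quantLin_phaseExp_mul hh _ (smoothField_killingJ m r) hψ hx, Finset.sum_congr rfl h1,
    ← Finset.mul_sum, Finset.sum_add_distrib, ← Finset.sum_mul, ← Complex.ofReal_sum, scalarB]
  simp only [Complex.ofReal_add, Complex.ofReal_sub, Complex.ofReal_mul, Complex.ofReal_div,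
    Complex.ofReal_one, Complex.ofReal_ofNat]
  ring

/-! ### Time derivatives -/

/-- `f` is differentiable at `x` with partial derivative `f'` in the direction `k`. -/
def HasPd {A : Type*} [NormedAddCommGroup A] [NormedSpace ℝ A] (k : Fin n) (f : Pt n → A)
    (f' : A) (x : Pt n) : Prop :=
  DifferentiableAt ℝ f x ∧ pd k f x = f'

section HasPd

variable {A : Type*} [NormedCommRing A] [NormedAlgebra ℝ A] {k : Fin n} {f g : Pt n → A}
  {f' g' : A} {x : Pt n}

lemma hasPd_const (c : A) : HasPd k (fun _ => c) 0 x :=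
  ⟨differentiableAt_const c, pd_const c k x⟩

lemma DifferentiableAt.hasPd (hf : DifferentiableAt ℝ f x) : HasPd k f (pd k f x) x :=
  ⟨hf, rfl⟩

lemma HasPd.add (hf : HasPd k f f' x) (hg : HasPd k g g' x) :
    HasPd k (fun y => f y + g y) (f' + g') x :=
  ⟨hf.1.add hg.1, by rw [pd_add k hf.1 hg.1, hf.2, hg.2]⟩

lemma HasPd.mul (hf : HasPd k f f' x) (hg : HasPd k g g' x) :
    HasPd k (fun y => f y * g y) (f' * g x + f x * g') x :=
  ⟨hf.1.mul hg.1, by rw [pd_mul k hf.1 hg.1, hf.2, hg.2]⟩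

lemma HasPd.const_mul (c : A) (hf : HasPd k f f' x) : HasPd k (fun y => c * f y) (c * f') x :=
  ⟨hf.1.const_mul c, by rw [pd_const_mul c k hf.1, hf.2]⟩

lemma HasPd.mul_const (hf : HasPd k f f' x) (c : A) : HasPd k (fun y => f y * c) (f' * c) x :=
  ⟨hf.1.mul_const c, by rw [pd_mul_const c k hf.1, hf.2]⟩

lemma HasPd.sum {ι : Type*} {u : Finset ι} {F : ι → Pt n → A} {F' : ι → A}
    (hF : ∀ i ∈ u, HasPd k (F i) (F' i) x) :
    HasPd k (fun y => ∑ i ∈ u, F i y) (∑ i ∈ u, F' i) x :=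
  ⟨DifferentiableAt.fun_sum fun i hi => (hF i hi).1, by
    rw [pd_sum u k fun i hi => (hF i hi).1]
    exact Finset.sum_congr rfl fun i hi => (hF i hi).2⟩

lemma HasPd.ofReal {f : Pt n → ℝ} {f' : ℝ} (hf : HasPd k f f' x) :
    HasPd k (fun y => (f y : ℂ)) (f' : ℂ) x :=
  ⟨Complex.ofRealCLM.differentiableAt.comp x hf.1, by rw [pd_ofReal k hf.1, hf.2]⟩

end HasPd

section Time

variable {T : Set (Pt n)} {d : ℤ → Pt n → ℝ} {t : Pt n}

lemma hasPd_phaseSum (m : ℕ) (hd : ∀ γ ∈ Finset.Icc (0 : ℤ) (n + 1), DifferentiableAt ℝ (d γ) t)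
    (s : Fin n) (x : Pt n) :
    HasPd s (fun τ => phaseSum m (fun γ => d γ τ) x)
      (phaseSum m (fun γ => pd s (d γ) t) x) t :=
  HasPd.sum fun γ hγ => (DifferentiableAt.hasPd (hd γ hγ)).mul_const _

lemma hasPd_phaseGrad (m : ℕ) (hd : ∀ γ ∈ Finset.Icc (0 : ℤ) (n + 1), DifferentiableAt ℝ (d γ) t)
    (s : Fin n) (x : Pt n) (k : Fin n) :
    HasPd s (fun τ => phaseGrad m (fun γ => d γ τ) x k)
      (phaseGrad m (fun γ => pd s (d γ) t) x k) t :=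
  HasPd.sum fun γ hγ => (DifferentiableAt.hasPd (hd γ hγ)).mul_const _

lemma pd_gaugeUdag (hbar : ℝ) (m : ℕ)
    (hd : ∀ γ ∈ Finset.Icc (0 : ℤ) (n + 1), DifferentiableAt ℝ (d γ) t) (s : Fin n) (x : Pt n) :
    pd s (fun τ => gaugeUdag hbar m d τ x) t = gaugeUdag hbar m d t x *
      (Complex.I / (hbar : ℂ) * ((phaseSum m (fun γ => pd s (d γ) t) x : ℝ) : ℂ)) := by
  have h := ((hasPd_phaseSum m hd s x).ofReal).const_mul (Complex.I / (hbar : ℂ))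
  simp only [gaugeUdag_eq_phaseExp, phaseExp]
  rw [pd_cexp s h.1, h.2]

/-- The part of the scalar potential of `ĥ_r^B` that is not of magnetic origin. -/
def scalarRest [NeZero n] (m : ℕ) (bbar : ℝ) (e : ℤ → Pt n → ℝ) (r : Fin n) (t x : Pt n) : ℝ :=
  bbar * eTop n m t * potV n r x - bbar * e (n - idx r) t

lemma differentiableAt_scalarRest [NeZero n] (m : ℕ) (bbar : ℝ) {e : ℤ → Pt n → ℝ} {r : Fin n}
    (he : DifferentiableAt ℝ (e (n - idx r)) t) (x : Pt n) :
    DifferentiableAt ℝ (fun τ => scalarRest m bbar e r τ x) t := by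
  have h : DifferentiableAt ℝ (fun τ : Pt n => eTop n m τ) t := by
    unfold eTop
    split_ifs
    · exact (differentiableAt_apply (𝕜 := ℝ) (0 : Fin n) t).exp
    · exact differentiableAt_const _
  exact ((h.const_mul bbar).mul_const _).sub (he.const_mul bbar)

/-- The derivative of the quadratic part is arranged so that the coefficient of `∂d_γ/∂t_s` is the
scalar that conjugation adds to `M̂_r^(γ)`. -/
lemma hasPd_scalarB [NeZero n] {m : ℕ}
    (hd : ∀ γ ∈ Finset.Icc (0 : ℤ) (n + 1), DifferentiableAt ℝ (d γ) t) (bbar : ℝ)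
    {e : ℤ → Pt n → ℝ} {r : Fin n} (he : DifferentiableAt ℝ (e (n - idx r)) t) (s : Fin n)
    (x : Pt n) :
    HasPd s (fun τ => scalarB m d bbar e r τ x)
      (∑ γ ∈ Finset.Icc (0 : ℤ) (n + 1), pd s (d γ) t *
          ∑ γ' ∈ Finset.Icc (0 : ℤ) (n + 1), d γ' t * potV (γ + γ' - m) r x +
        ∑ i, killingJ m r x i * phaseGrad m (fun γ => pd s (d γ) t) x i +
        pd s (fun τ => scalarRest m bbar e r τ x) t) t := by
  have h1 : HasPd s (fun τ => (1 / 2) * (∑ γ ∈ Finset.Icc (0 : ℤ) (n + 1),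
      ∑ γ' ∈ Finset.Icc (0 : ℤ) (n + 1), d γ τ * d γ' τ * potV (γ + γ' - m) r x))
      ((1 / 2) * ∑ γ ∈ Finset.Icc (0 : ℤ) (n + 1), ∑ γ' ∈ Finset.Icc (0 : ℤ) (n + 1),
        (pd s (d γ) t * d γ' t + d γ t * pd s (d γ') t) * potV (γ + γ' - m) r x) t :=
    (HasPd.sum fun γ hγ => HasPd.sum fun γ' hγ' =>
      ((DifferentiableAt.hasPd (hd γ hγ)).mul
        (DifferentiableAt.hasPd (hd γ' hγ'))).mul_const _).const_mul _
  have h2 : HasPd s (fun τ => ∑ i, killingJ m r x i * phaseGrad m (fun γ => d γ τ) x i)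
      (∑ i, killingJ m r x i * phaseGrad m (fun γ => pd s (d γ) t) x i) t :=
    HasPd.sum fun i _ => (hasPd_phaseGrad m hd s x i).const_mul _
  have h3 : HasPd s (fun τ => scalarRest m bbar e r τ x)
      (pd s (fun τ => scalarRest m bbar e r τ x) t) t :=
    DifferentiableAt.hasPd (differentiableAt_scalarRest m bbar he x)
  have h4 : (1 / 2) * ∑ γ ∈ Finset.Icc (0 : ℤ) (n + 1), ∑ γ' ∈ Finset.Icc (0 : ℤ) (n + 1),
        (pd s (d γ) t * d γ' t + d γ t * pd s (d γ') t) * potV (γ + γ' - m) r x =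
      ∑ γ ∈ Finset.Icc (0 : ℤ) (n + 1), pd s (d γ) t *
          ∑ γ' ∈ Finset.Icc (0 : ℤ) (n + 1), d γ' t * potV (γ + γ' - m) r x := by
    simp only [add_mul, Finset.sum_add_distrib, Finset.mul_sum (s := Finset.Icc (0 : ℤ) (n + 1))]
    -- The potential depends only on `γ + γ'`, so the two halves of the product rule are equal and
    -- cancel the factor `½`.
    have h5 : ∑ γ ∈ Finset.Icc (0 : ℤ) (n + 1), ∑ γ' ∈ Finset.Icc (0 : ℤ) (n + 1),
        d γ t * pd s (d γ') t * potV (γ + γ' - m) r x =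
        ∑ γ ∈ Finset.Icc (0 : ℤ) (n + 1), ∑ γ' ∈ Finset.Icc (0 : ℤ) (n + 1),
          pd s (d γ) t * d γ' t * potV (γ + γ' - m) r x := by
      rw [Finset.sum_comm]
      refine Finset.sum_congr rfl fun γ _ => Finset.sum_congr rfl fun γ' _ => ?_
      rw [add_comm γ' γ]
      ring
    rw [h5, ← two_mul, ← mul_assoc]
    norm_num
    simp only [mul_assoc]
  rw [← h4]
  exact (h1.add h2).add h3

lemma differentiableAt_deformCoeff {m : ℕ} {ζ : Fin n → Fin n → Pt n → ℝ} {r j : Fin n}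
    (hζ : DifferentiableAt ℝ (ζ r j) t) :
    DifferentiableAt ℝ (fun τ => deformCoeff m ζ r j τ) t := by
  unfold deformCoeff
  split_ifs
  · exact differentiableAt_const _
  · exact hζ
  · exact differentiableAt_const _
  · exact hζ
  · exact differentiableAt_const _

lemma pd_pd_comm {f : Pt n → ℝ} (hT : IsOpen T) (hf : ContDiffOn ℝ ∞ f T) (ht : t ∈ T)
    (r s : Fin n) : pd s (fun τ => pd r f τ) t = pd r (fun τ => pd s f τ) t := by
  have hc : ContDiffAt ℝ ∞ f t := hf.contDiffAt (hT.mem_nhds ht)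
  have hsymm : IsSymmSndFDerivAt ℝ f t := hc.isSymmSndFDerivAt (by
    rw [minSmoothness_of_isRCLikeNormedField]
    exact WithTop.coe_le_coe.2 le_top)
  have hd : DifferentiableAt ℝ (fderiv ℝ f) t :=
    (hc.fderiv_right (m := 1) (by norm_cast)).differentiableAt (by simp)
  have h : ∀ v w : Pt n, fderiv ℝ (fun τ => fderiv ℝ f τ v) t w = fderiv ℝ (fderiv ℝ f) t w v := by
    intro v w
    rw [fderiv_clm_apply hd (differentiableAt_const v)]
    simp
  simp only [pd]
  rw [h, h]
  exact hsymm _ _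

end Time

/-! ### Locality, additivity and smoothness of the geodesic operators -/

/-- In a product of two operators the inner result is known only on the configuration space;
locality on this open set makes that sufficient. -/
lemma quantQuad_congr (hbar : ℝ) (m : ℕ) (C : Pt n → Matrix (Fin n) (Fin n) ℝ) {φ ψ : Pt n → ℂ}
    (h : Set.EqOn φ ψ (configSpace n m)) {x : Pt n} (hx : x ∈ configSpace n m) :
    quantQuad hbar m C φ x = quantQuad hbar m C ψ x := by
  have ho := isOpen_configSpace n m
  unfold quantQuad
  congr 1
  refine Finset.sum_congr rfl fun k _ => pd_congr_of_isOpen ho (fun y hy => ?_) k hx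
  congr 1
  exact Finset.sum_congr rfl fun j _ => by rw [pd_congr_of_isOpen ho h j hy]

lemma quantLin_congr (hbar : ℝ) (m : ℕ) (X : Pt n → Fin n → ℝ) {φ ψ : Pt n → ℂ}
    (h : Set.EqOn φ ψ (configSpace n m)) {x : Pt n} (hx : x ∈ configSpace n m) :
    quantLin hbar m X φ x = quantLin hbar m X ψ x := by
  have ho := isOpen_configSpace n m
  unfold quantLin
  congr 1
  congr 1
  · congr 1
    exact Finset.sum_congr rfl fun k _ =>
      pd_congr_of_isOpen ho (fun y hy => by simp only [h hy]) k hx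
  · exact Finset.sum_congr rfl fun j _ => by rw [pd_congr_of_isOpen ho h j hx]

lemma geodesicOp_congr (hbar : ℝ) (m : ℕ) (r : Fin n) {φ ψ : Pt n → ℂ}
    (h : Set.EqOn φ ψ (configSpace n m)) {x : Pt n} (hx : x ∈ configSpace n m) :
    geodesicOp hbar m r φ x = geodesicOp hbar m r ψ x := by
  rw [geodesicOp, geodesicOp, quantQuad_congr hbar m _ h hx, quantLin_congr hbar m _ h hx]

lemma hB_congr [NeZero n] (hbar : ℝ) (m : ℕ) (d : ℤ → Pt n → ℝ) (bbar : ℝ) (e : ℤ → Pt n → ℝ)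
    (r : Fin n) (t : Pt n) {φ ψ : Pt n → ℂ} (h : Set.EqOn φ ψ (configSpace n m)) {x : Pt n}
    (hx : x ∈ configSpace n m) : hB hbar m d bbar e r t φ x = hB hbar m d bbar e r t ψ x := by
  unfold hB
  rw [geodesicOp_congr hbar m r h hx, h hx]
  simp only [quantLin_congr hbar m _ h hx]

lemma quantQuad_add (hbar : ℝ) (m : ℕ) (r : Fin n) {φ ψ : Pt n → ℂ} (hφ : SmoothOn m φ)
    (hψ : SmoothOn m ψ) {x : Pt n} (hx : x ∈ configSpace n m) :
    quantQuad hbar m (tensorA m r) (fun y => φ y + ψ y) x =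
      quantQuad hbar m (tensorA m r) φ x + quantQuad hbar m (tensorA m r) ψ x := by
  rw [quantQuad_tensorA, quantQuad_tensorA, quantQuad_tensorA, ← mul_add,
    ← Finset.sum_add_distrib]
  congr 1
  refine Finset.sum_congr rfl fun k _ => ?_
  have hva := (smoothOn_vol m).mul (smoothOn_tensorA m r k)
  rw [← pd_add k (SmoothOn.diff (hva.mul (hφ.pd k)) hx) (SmoothOn.diff (hva.mul (hψ.pd k)) hx)]
  refine pd_congr_of_isOpen (isOpen_configSpace n m) (fun y hy => ?_) k hx
  rw [pd_add k (hφ.diff hy) (hψ.diff hy), mul_add]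

lemma quantLin_add (hbar : ℝ) {m : ℕ} {X : Pt n → Fin n → ℝ} (hX : SmoothField m X)
    {φ ψ : Pt n → ℂ} (hφ : SmoothOn m φ) (hψ : SmoothOn m ψ) {x : Pt n}
    (hx : x ∈ configSpace n m) :
    quantLin hbar m X (fun y => φ y + ψ y) x =
      quantLin hbar m X φ x + quantLin hbar m X ψ x := by
  rw [quantLin_eq hbar hX hφ hx, quantLin_eq hbar hX hψ hx,
    quantLin_eq hbar hX (ContDiffOn.add hφ hψ) hx]
  have h : ∑ j, ((X x j : ℝ) : ℂ) * pd j (fun y => φ y + ψ y) x =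
      ∑ j, ((X x j : ℝ) : ℂ) * pd j φ x + ∑ j, ((X x j : ℝ) : ℂ) * pd j ψ x := by
    rw [← Finset.sum_add_distrib]
    exact Finset.sum_congr rfl fun j _ => by rw [pd_add j (hφ.diff hx) (hψ.diff hx), mul_add]
  rw [h]
  simp only [← Finset.sum_mul]
  ring

lemma geodesicOp_add (hbar : ℝ) {m : ℕ} (r : Fin n) {φ ψ : Pt n → ℂ} (hφ : SmoothOn m φ)
    (hψ : SmoothOn m ψ) {x : Pt n} (hx : x ∈ configSpace n m) :
    geodesicOp hbar m r (fun y => φ y + ψ y) x =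
      geodesicOp hbar m r φ x + geodesicOp hbar m r ψ x := by
  unfold geodesicOp
  rw [quantQuad_add hbar m r hφ hψ hx, quantLin_add hbar (smoothField_killingJ m r) hφ hψ hx]
  ring

lemma smoothOn_geodesicOp (hbar : ℝ) {m : ℕ} (r : Fin n) {ψ : Pt n → ℂ} (hψ : SmoothOn m ψ) :
    SmoothOn m (geodesicOp hbar m r ψ) := by
  have hv : SmoothOn m (fun y : Pt n => ((vol m y : ℝ) : ℂ)⁻¹) :=
    (smoothOn_vol m).inv fun x hx => Complex.ofReal_ne_zero.2 (vol_ne_zero hx)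
  refine ContDiffOn.add ?_ ?_
  · refine ContDiffOn.congr ?_ fun x _ => quantQuad_tensorA hbar m r ψ x
    refine (contDiffOn_const.mul hv).mul (ContDiffOn.sum fun k _ => SmoothOn.pd ?_ k)
    exact ((smoothOn_vol m).mul (smoothOn_tensorA m r k)).mul (hψ.pd k)
  · unfold quantLin
    refine contDiffOn_const.mul (ContDiffOn.add ?_ ?_)
    · refine hv.mul (ContDiffOn.sum fun k _ => SmoothOn.pd ?_ k)
      exact ((smoothOn_vol m).mul ((smoothField_killingJ m r).ofReal k)).mul hψ
    · exact ContDiffOn.sum fun k _ => ((smoothField_killingJ m r).ofReal k).mul (hψ.pd k)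

lemma contDiffOn_scalarB [NeZero n] (m : ℕ) (d : ℤ → Pt n → ℝ) (bbar : ℝ) (e : ℤ → Pt n → ℝ)
    (r : Fin n) (t : Pt n) :
    ContDiffOn ℝ ∞ (fun x => scalarB m d bbar e r t x) (configSpace n m) := by
  unfold scalarB
  refine ContDiffOn.add (ContDiffOn.add (contDiffOn_const.mul (ContDiffOn.sum fun γ hγ =>
    ContDiffOn.sum fun γ' hγ' => contDiffOn_const.mul (contDiffOn_potV r ?_)))
    (ContDiffOn.sum fun i _ => (contDiffOn_killingJ m r i).mul (contDiffOn_phaseGrad m _ i)))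
    ((contDiffOn_const.mul (contDiffOn_potV r (by omega))).sub contDiffOn_const)
  rw [Finset.mem_Icc] at hγ hγ'
  omega

/-! ### The deformed operators -/

/-- The geodesic part of the deformed operators. -/
def deformGeo (hbar : ℝ) (m : ℕ) (ζ : Fin n → Fin n → Pt n → ℝ) (r : Fin n) (t : Pt n) : Op n :=
  fun ψ x => ∑ j, ((deformCoeff m ζ r j t : ℝ) : ℂ) * geodesicOp hbar m j ψ x

/-- The scalar part of the gauge transform of the deformed magnetic operators. -/
def deformScalar [NeZero n] (m : ℕ) (ζ : Fin n → Fin n → Pt n → ℝ) (d : ℤ → Pt n → ℝ) (bbar : ℝ)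
    (e : ℤ → Pt n → ℝ) (r : Fin n) (t x : Pt n) : ℝ :=
  ∑ j, deformCoeff m ζ r j t * scalarB m d bbar e j t x

/-- The PDE system enters here: the A operator is the conjugated B operator plus multiplication by
the time derivative of the phase. -/
lemma deform_hA_eq [NeZero n] (hbar : ℝ) {m : ℕ} (hm : m ≤ n + 1)
    {ζ : Fin n → Fin n → Pt n → ℝ} {d : ℤ → Pt n → ℝ} {T : Set (Pt n)}
    (hPDE : PDESystem m ζ d T) (bbar : ℝ) (e : ℤ → Pt n → ℝ) (r : Fin n) {t : Pt n} (ht : t ∈ T)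
    (ψ : Pt n → ℂ) {x : Pt n} (hx : x ∈ configSpace n m) :
    deform m ζ (hA hbar m (cOf m d bbar e)) r t ψ x =
      deformGeo hbar m ζ r t ψ x + ((deformScalar m ζ d bbar e r t x : ℝ) : ℂ) * ψ x +
        ((phaseSum m (fun γ => pd r (d γ) t) x : ℝ) : ℂ) * ψ x := by
  rw [← sum_deformCoeff_scalar hm hPDE bbar e r ht hx, deform, deformGeo, deformScalar]
  push_cast
  rw [Finset.sum_mul, Finset.sum_mul, ← Finset.sum_add_distrib, ← Finset.sum_add_distrib]
  refine Finset.sum_congr rfl fun j _ => ?_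
  rw [hA, ← scalarA]
  ring

lemma deform_hB_gaugeUdag_mul [NeZero n] {hbar : ℝ} (hh : hbar ≠ 0) {m : ℕ}
    (ζ : Fin n → Fin n → Pt n → ℝ) (d : ℤ → Pt n → ℝ) (bbar : ℝ) (e : ℤ → Pt n → ℝ) (r : Fin n)
    (t : Pt n) {ψ : Pt n → ℂ} (hψ : SmoothOn m ψ) {x : Pt n} (hx : x ∈ configSpace n m) :
    deform m ζ (hB hbar m d bbar e) r t (fun y => gaugeUdag hbar m d t y * ψ y) x =
      gaugeUdag hbar m d t x * (deformGeo hbar m ζ r t ψ x +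
        ((deformScalar m ζ d bbar e r t x : ℝ) : ℂ) * ψ x) := by
  rw [deform, deformGeo, deformScalar]
  push_cast
  rw [Finset.sum_mul, ← Finset.sum_add_distrib, Finset.mul_sum]
  refine Finset.sum_congr rfl fun j _ => ?_
  rw [hB_gaugeUdag_mul hh d bbar e j t hψ hx]
  ring

lemma deformGeo_congr (hbar : ℝ) (m : ℕ) (ζ : Fin n → Fin n → Pt n → ℝ) (r : Fin n) (t : Pt n)
    {φ ψ : Pt n → ℂ} (h : Set.EqOn φ ψ (configSpace n m)) {x : Pt n}
    (hx : x ∈ configSpace n m) : deformGeo hbar m ζ r t φ x = deformGeo hbar m ζ r t ψ x :=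
  Finset.sum_congr rfl fun j _ => by rw [geodesicOp_congr hbar m j h hx]

lemma deform_hB_congr [NeZero n] (hbar : ℝ) (m : ℕ) (ζ : Fin n → Fin n → Pt n → ℝ)
    (d : ℤ → Pt n → ℝ) (bbar : ℝ) (e : ℤ → Pt n → ℝ) (r : Fin n) (t : Pt n)
    {φ ψ : Pt n → ℂ} (h : Set.EqOn φ ψ (configSpace n m)) {x : Pt n} (hx : x ∈ configSpace n m) :
    deform m ζ (hB hbar m d bbar e) r t φ x = deform m ζ (hB hbar m d bbar e) r t ψ x :=
  Finset.sum_congr rfl fun j _ => by rw [hB_congr hbar m d bbar e j t h hx]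

lemma deformGeo_add (hbar : ℝ) {m : ℕ} (ζ : Fin n → Fin n → Pt n → ℝ) (r : Fin n) (t : Pt n)
    {φ ψ : Pt n → ℂ} (hφ : SmoothOn m φ) (hψ : SmoothOn m ψ) {x : Pt n}
    (hx : x ∈ configSpace n m) :
    deformGeo hbar m ζ r t (fun y => φ y + ψ y) x =
      deformGeo hbar m ζ r t φ x + deformGeo hbar m ζ r t ψ x := by
  simp only [deformGeo]
  rw [← Finset.sum_add_distrib]
  exact Finset.sum_congr rfl fun j _ => by rw [geodesicOp_add hbar j hφ hψ hx, mul_add]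

/-- The commutator of the geodesic part with a phase, up to the factor `i ħ`. -/
def phaseCommutator (hbar : ℝ) (m : ℕ) (ζ : Fin n → Fin n → Pt n → ℝ) (a : ℤ → ℝ) (r : Fin n)
    (t : Pt n) (ψ : Pt n → ℂ) (x : Pt n) : ℂ :=
  ∑ j, ((deformCoeff m ζ r j t : ℝ) : ℂ) *
    ((∑ γ ∈ Finset.Icc (0 : ℤ) (n + 1), ((a γ : ℝ) : ℂ) * quantLin hbar m (vecP γ j) ψ x) -
      ((∑ i, killingJ m j x i * phaseGrad m a x i : ℝ) : ℂ) * ψ x)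

lemma deformGeo_phaseSum_mul (hbar : ℝ) {m : ℕ} (ζ : Fin n → Fin n → Pt n → ℝ) (a : ℤ → ℝ)
    (r : Fin n) (t : Pt n) {ψ : Pt n → ℂ} (hψ : SmoothOn m ψ) {x : Pt n}
    (hx : x ∈ configSpace n m) :
    deformGeo hbar m ζ r t (fun y => ((phaseSum m a y : ℝ) : ℂ) * ψ y) x =
      ((phaseSum m a x : ℝ) : ℂ) * deformGeo hbar m ζ r t ψ x +
        Complex.I * (hbar : ℂ) * phaseCommutator hbar m ζ a r t ψ x := by
  simp only [deformGeo, phaseCommutator]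
  rw [Finset.mul_sum, Finset.mul_sum, ← Finset.sum_add_distrib]
  refine Finset.sum_congr rfl fun j _ => ?_
  rw [geodesicOp_phaseSum_mul hbar a j hψ hx]
  ring

lemma smoothOn_deformGeo (hbar : ℝ) {m : ℕ} (ζ : Fin n → Fin n → Pt n → ℝ) (r : Fin n)
    (t : Pt n) {ψ : Pt n → ℂ} (hψ : SmoothOn m ψ) : SmoothOn m (deformGeo hbar m ζ r t ψ) :=
  ContDiffOn.sum fun j _ => contDiffOn_const.mul (smoothOn_geodesicOp hbar j hψ)

lemma smoothOn_deformScalar [NeZero n] (m : ℕ) (ζ : Fin n → Fin n → Pt n → ℝ) (d : ℤ → Pt n → ℝ)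
    (bbar : ℝ) (e : ℤ → Pt n → ℝ) (r : Fin n) (t : Pt n) :
    SmoothOn m (fun x => ((deformScalar m ζ d bbar e r t x : ℝ) : ℂ)) :=
  contDiffOn_ofReal (ContDiffOn.sum fun j _ =>
    contDiffOn_const.mul (contDiffOn_scalarB m d bbar e j t))

/-! ### Gauge equivalence of the Frobenius defects -/

section Frobenius

variable [NeZero n] {m : ℕ} {hbar : ℝ} {bbar : ℝ} {T : Set (Pt n)}
  {ζ : Fin n → Fin n → Pt n → ℝ} {d e : ℤ → Pt n → ℝ} {t : Pt n}

/-- The products of two deformed operators of the two families. -/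
lemma deform_hA_comm (hh : hbar ≠ 0) (hm : m ≤ n + 1) (hPDE : PDESystem m ζ d T)
    (ht : t ∈ T) (r s : Fin n) {ψ : Pt n → ℂ} (hψ : SmoothOn m ψ) {x : Pt n}
    (hx : x ∈ configSpace n m) :
    deform m ζ (hA hbar m (cOf m d bbar e)) r t
        (deform m ζ (hA hbar m (cOf m d bbar e)) s t ψ) x =
      gaugeU hbar m d t x * deform m ζ (hB hbar m d bbar e) r t
        (deform m ζ (hB hbar m d bbar e) s t (fun y => gaugeUdag hbar m d t y * ψ y)) x +
      (((phaseSum m (fun γ => pd s (d γ) t) x : ℝ) : ℂ) *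
          (deformGeo hbar m ζ r t ψ x + ((deformScalar m ζ d bbar e r t x : ℝ) : ℂ) * ψ x) +
        ((phaseSum m (fun γ => pd r (d γ) t) x : ℝ) : ℂ) *
          (deformGeo hbar m ζ s t ψ x + ((deformScalar m ζ d bbar e s t x : ℝ) : ℂ) * ψ x) +
        ((phaseSum m (fun γ => pd r (d γ) t) x : ℝ) : ℂ) *
          ((phaseSum m (fun γ => pd s (d γ) t) x : ℝ) : ℂ) * ψ x) +
      Complex.I * (hbar : ℂ) *
        phaseCommutator hbar m ζ (fun γ => pd s (d γ) t) r t ψ x := by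
  set W : Pt n → ℂ := fun y => ((phaseSum m (fun γ => pd s (d γ) t) y : ℝ) : ℂ) with hW
  set φ : Pt n → ℂ := fun y => deformGeo hbar m ζ s t ψ y +
    ((deformScalar m ζ d bbar e s t y : ℝ) : ℂ) * ψ y with hφdef
  have hφ : SmoothOn m φ :=
    ContDiffOn.add (smoothOn_deformGeo hbar ζ s t hψ)
      ((smoothOn_deformScalar m ζ d bbar e s t).mul hψ)
  have hWψ : SmoothOn m (fun y => W y * ψ y) := (smoothOn_phaseSum m _).mul hψ
  have hA' : Set.EqOn (deform m ζ (hA hbar m (cOf m d bbar e)) s t ψ)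
      (fun y => φ y + W y * ψ y) (configSpace n m) :=
    fun y hy => deform_hA_eq hbar hm hPDE bbar e s ht ψ hy
  have hB' : Set.EqOn
      (deform m ζ (hB hbar m d bbar e) s t (fun y => gaugeUdag hbar m d t y * ψ y))
      (fun y => gaugeUdag hbar m d t y * φ y) (configSpace n m) :=
    fun y hy => deform_hB_gaugeUdag_mul hh ζ d bbar e s t hψ hy
  -- Only the geodesic part fails to commute with the phase `W`. The remaining extra terms are
  -- symmetric in `r` and `s` and disappear from the commutator.
  rw [deform_hA_eq hbar hm hPDE bbar e r ht _ hx, hA' hx, deformGeo_congr hbar m ζ r t hA' hx,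
    deformGeo_add hbar ζ r t hφ hWψ hx, deformGeo_phaseSum_mul hbar ζ _ r t hψ hx,
    deform_hB_congr hbar m ζ d bbar e r t hB' hx, deform_hB_gaugeUdag_mul hh ζ d bbar e r t hφ hx,
    ← mul_assoc (gaugeU hbar m d t x), gaugeU_mul_gaugeUdag, one_mul]
  simp only [hφdef, hW]
  ring

/-- The time derivatives of the two families of operators. -/
lemma pd_deform_hA (hh : hbar ≠ 0) (hm : m ≤ n + 1) (hT : IsOpen T)
    (hζ : ∀ r j, ContDiffOn ℝ ∞ (ζ r j) T)
    (hd : ∀ γ ∈ Finset.Icc (0 : ℤ) (n + 1), ContDiffOn ℝ ∞ (d γ) T)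
    (he : ∀ k ∈ Finset.Icc (0 : ℤ) (n - 1), ContDiffOn ℝ ∞ (e k) T)
    (hPDE : PDESystem m ζ d T) (ht : t ∈ T) (r s : Fin n) {ψ : Pt n → ℂ} (hψ : SmoothOn m ψ)
    {x : Pt n} (hx : x ∈ configSpace n m) :
    pd s (fun τ => deform m ζ (hA hbar m (cOf m d bbar e)) r τ ψ x) t =
      gaugeU hbar m d t x * pd s (fun τ => deform m ζ (hB hbar m d bbar e) r τ
        (fun y => gaugeUdag hbar m d t y * ψ y) x) t -
      phaseCommutator hbar m ζ (fun γ => pd s (d γ) t) r t ψ x +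
      ((phaseSum m (fun γ => pd s (fun τ => pd r (d γ) τ) t) x : ℝ) : ℂ) * ψ x := by
  have hdt : ∀ γ ∈ Finset.Icc (0 : ℤ) (n + 1), DifferentiableAt ℝ (d γ) t := fun γ hγ =>
    differentiableAt_of_contDiffOn hT (hd γ hγ) ht
  have hdrt : ∀ γ ∈ Finset.Icc (0 : ℤ) (n + 1),
      DifferentiableAt ℝ (fun τ => pd r (d γ) τ) t := fun γ hγ =>
    differentiableAt_of_contDiffOn hT (contDiffOn_pd hT (hd γ hγ) r) ht
  have het : ∀ j : Fin n, DifferentiableAt ℝ (e (n - idx j)) t := fun j =>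
    differentiableAt_of_contDiffOn hT (he _ (by
      have := j.2
      rw [Finset.mem_Icc]
      simp only [idx]
      omega)) ht
  have hζt : ∀ j, HasPd s (fun τ => deformCoeff m ζ r j τ)
      (pd s (fun τ => deformCoeff m ζ r j τ) t) t := fun j => DifferentiableAt.hasPd
    (differentiableAt_deformCoeff (differentiableAt_of_contDiffOn hT (hζ r j) ht))
  -- Rewriting by the PDE system before differentiating avoids any derivative of the coefficients
  -- `c_α`; it is valid near `t` because `T` is open.
  have hAeq : ∀ τ ∈ T, deform m ζ (hA hbar m (cOf m d bbar e)) r τ ψ x =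
      (∑ j, ((deformCoeff m ζ r j τ : ℝ) : ℂ) * geodesicOp hbar m j ψ x +
        ((∑ j, deformCoeff m ζ r j τ * scalarB m d bbar e j τ x : ℝ) : ℂ) * ψ x) +
      ((phaseSum m (fun γ => pd r (d γ) τ) x : ℝ) : ℂ) * ψ x :=
    fun τ hτ => deform_hA_eq hbar hm hPDE bbar e r hτ ψ hx
  have hA1 := (((HasPd.sum fun j (_ : j ∈ Finset.univ) =>
      (hζt j).ofReal.mul_const (geodesicOp hbar m j ψ x)).add
      ((HasPd.sum fun j (_ : j ∈ Finset.univ) =>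
        (hζt j).mul (hasPd_scalarB (m := m) hdt bbar (het j) s x)).ofReal.mul_const (ψ x))).add
      ((hasPd_phaseSum m hdrt s x).ofReal.mul_const (ψ x))).2
  have hB1 := (HasPd.sum fun j (_ : j ∈ Finset.univ) => (hζt j).ofReal.mul
      (((hasPd_const (k := s) (x := t) (geodesicOp hbar m j
          (fun y => gaugeUdag hbar m d t y * ψ y) x)).add
        (HasPd.sum fun γ (hγ : γ ∈ Finset.Icc (0 : ℤ) (n + 1)) =>
          (DifferentiableAt.hasPd (k := s) (hdt γ hγ)).ofReal.mul_const
            (quantLin hbar m (vecP γ j) (fun y => gaugeUdag hbar m d t y * ψ y) x))).add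
        ((DifferentiableAt.hasPd (k := s)
          (differentiableAt_scalarRest m bbar (het j) x)).ofReal.mul_const
            (gaugeUdag hbar m d t x * ψ x)))).2
  -- The factor `U†` stays at the fixed time `t`: only the coefficients of the operator are
  -- differentiated.
  have hBeq : (fun τ => deform m ζ (hB hbar m d bbar e) r τ
        (fun y => gaugeUdag hbar m d t y * ψ y) x) = fun τ =>
      ∑ j, ((deformCoeff m ζ r j τ : ℝ) : ℂ) *
        (geodesicOp hbar m j (fun y => gaugeUdag hbar m d t y * ψ y) x +
          (∑ γ ∈ Finset.Icc (0 : ℤ) (n + 1), ((d γ τ : ℝ) : ℂ) *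
            quantLin hbar m (vecP γ j) (fun y => gaugeUdag hbar m d t y * ψ y) x) +
          ((scalarRest m bbar e j τ x : ℝ) : ℂ) * (gaugeUdag hbar m d t x * ψ x)) := rfl
  rw [pd_congr_of_isOpen hT hAeq s ht, hA1, hBeq, hB1, phaseCommutator]
  congr 1
  have hg : ∀ j : Fin n, geodesicOp hbar m j (fun y => gaugeUdag hbar m d t y * ψ y) x +
      (∑ γ ∈ Finset.Icc (0 : ℤ) (n + 1), ((d γ t : ℝ) : ℂ) *
        quantLin hbar m (vecP γ j) (fun y => gaugeUdag hbar m d t y * ψ y) x) +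
      ((scalarRest m bbar e j t x : ℝ) : ℂ) * (gaugeUdag hbar m d t x * ψ x) =
      gaugeUdag hbar m d t x *
        (geodesicOp hbar m j ψ x + ((scalarB m d bbar e j t x : ℝ) : ℂ) * ψ x) :=
    fun j => hB_gaugeUdag_mul hh d bbar e j t hψ hx
  have hq : ∀ j : Fin n, ∑ γ ∈ Finset.Icc (0 : ℤ) (n + 1), ((pd s (d γ) t : ℝ) : ℂ) *
      quantLin hbar m (vecP γ j) (fun y => gaugeUdag hbar m d t y * ψ y) x =
      gaugeUdag hbar m d t x *
        (∑ γ ∈ Finset.Icc (0 : ℤ) (n + 1),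
            ((pd s (d γ) t : ℝ) : ℂ) * quantLin hbar m (vecP γ j) ψ x +
          ((∑ γ ∈ Finset.Icc (0 : ℤ) (n + 1), pd s (d γ) t *
            ∑ γ' ∈ Finset.Icc (0 : ℤ) (n + 1), d γ' t * potV (γ + γ' - m) j x : ℝ) : ℂ) *
            ψ x) := by
    intro j
    rw [Complex.ofReal_sum, Finset.sum_mul, ← Finset.sum_add_distrib, Finset.mul_sum]
    refine Finset.sum_congr rfl fun γ hγ => ?_
    have hγ0 := (Finset.mem_Icc.1 hγ).1
    simp only [gaugeUdag_eq_phaseExp]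
    rw [quantLin_phaseExp_mul hh _ (smoothField_vecP m j hγ0) hψ hx,
      sum_vecP_mul_phaseGrad _ j hγ0 hx, Complex.ofReal_mul]
    ring
  simp only [hg, hq]
  rw [Complex.ofReal_sum, Finset.sum_mul, ← Finset.sum_add_distrib, Finset.mul_sum,
    ← Finset.sum_sub_distrib]
  refine Finset.sum_congr rfl fun j _ => ?_
  have hU := gaugeU_mul_gaugeUdag hbar m d t x
  simp only [Complex.ofReal_add, Complex.ofReal_mul]
  have hfin : ∀ Z G D z P J R Ψ M : ℂ, Z * G + (Z * D + z * (P + J + R)) * Ψ =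
      gaugeU hbar m d t x * (Z * (gaugeUdag hbar m d t x * (G + D * Ψ)) +
        z * (0 + gaugeUdag hbar m d t x * (M + P * Ψ) + R * (gaugeUdag hbar m d t x * Ψ))) -
      z * (M - J * Ψ) := by
    intro Z G D z P J R Ψ M
    linear_combination -(Z * (G + D * Ψ) + z * (M + P * Ψ + R * Ψ)) * hU
  exact hfin _ _ _ _ _ _ _ _ _

/-- The Frobenius defects of the two families are gauge equivalent. -/
lemma frobenius_defect (hh : hbar ≠ 0) (hm : m ≤ n + 1) (hT : IsOpen T)
    (hζ : ∀ r j, ContDiffOn ℝ ∞ (ζ r j) T)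
    (hd : ∀ γ ∈ Finset.Icc (0 : ℤ) (n + 1), ContDiffOn ℝ ∞ (d γ) T)
    (he : ∀ k ∈ Finset.Icc (0 : ℤ) (n - 1), ContDiffOn ℝ ∞ (e k) T)
    (hPDE : PDESystem m ζ d T) (ht : t ∈ T) (r s : Fin n) {ψ : Pt n → ℂ} (hψ : SmoothOn m ψ)
    {x : Pt n} (hx : x ∈ configSpace n m) :
    Complex.I * (hbar : ℂ) *
          pd s (fun τ => deform m ζ (hA hbar m (cOf m d bbar e)) r τ ψ x) t -
        Complex.I * (hbar : ℂ) *
          pd r (fun τ => deform m ζ (hA hbar m (cOf m d bbar e)) s τ ψ x) t +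
        (deform m ζ (hA hbar m (cOf m d bbar e)) r t
            (deform m ζ (hA hbar m (cOf m d bbar e)) s t ψ) x -
          deform m ζ (hA hbar m (cOf m d bbar e)) s t
            (deform m ζ (hA hbar m (cOf m d bbar e)) r t ψ) x) =
      gaugeU hbar m d t x *
        (Complex.I * (hbar : ℂ) * pd s (fun τ => deform m ζ (hB hbar m d bbar e) r τ
            (fun y => gaugeUdag hbar m d t y * ψ y) x) t -
          Complex.I * (hbar : ℂ) * pd r (fun τ => deform m ζ (hB hbar m d bbar e) s τ
            (fun y => gaugeUdag hbar m d t y * ψ y) x) t +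
          (deform m ζ (hB hbar m d bbar e) r t (deform m ζ (hB hbar m d bbar e) s t
              (fun y => gaugeUdag hbar m d t y * ψ y)) x -
            deform m ζ (hB hbar m d bbar e) s t (deform m ζ (hB hbar m d bbar e) r t
              (fun y => gaugeUdag hbar m d t y * ψ y)) x)) := by
  have hsym : phaseSum m (fun γ => pd s (fun τ => pd r (d γ) τ) t) x =
      phaseSum m (fun γ => pd r (fun τ => pd s (d γ) τ) t) x :=
    Finset.sum_congr rfl fun γ hγ => by
      simp only [pd_pd_comm hT (hd γ hγ) ht r s]
  -- The phase commutator enters with `+iħ` from the operator product and with `-1`, multiplied by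
  -- `iħ`, from the time derivative, so it cancels; `hsym` removes the second derivatives of the
  -- phase.
  rw [deform_hA_comm hh hm hPDE ht r s hψ hx, deform_hA_comm hh hm hPDE ht s r hψ hx,
    pd_deform_hA hh hm hT hζ hd he hPDE ht r s hψ hx,
    pd_deform_hA hh hm hT hζ hd he hPDE ht s r hψ hx, hsym]
  ring

end Frobenius

end QPainleve

end

theorem mainTheorem4 (n m : ℕ) [NeZero n] (hm : m ≤ n + 1) (hbar : ℝ) (hhbar : 0 < hbar)
    (bbar : ℝ) (T : Set (QPainleve.Pt n)) (hT : IsOpen T)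
    (ζ : Fin n → Fin n → QPainleve.Pt n → ℝ) (hζ : ∀ r j, ContDiffOn ℝ ∞ (ζ r j) T)
    (d : ℤ → QPainleve.Pt n → ℝ)
    (hd : ∀ γ ∈ Finset.Icc (0 : ℤ) (n + 1), ContDiffOn ℝ ∞ (d γ) T)
    (e : ℤ → QPainleve.Pt n → ℝ)
    (he : ∀ k ∈ Finset.Icc (0 : ℤ) (n - 1), ContDiffOn ℝ ∞ (e k) T)
    (hPDE : QPainleve.PDESystem m ζ d T) :
    (∀ t ∈ T, ∀ r : Fin n, ∀ ψ : QPainleve.Pt n → ℂ,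
      ContDiffOn ℝ ∞ ψ (QPainleve.configSpace n m) →
      ∀ x ∈ QPainleve.configSpace n m,
        QPainleve.deform m ζ (QPainleve.hA hbar m (QPainleve.cOf m d bbar e)) r t ψ x =
          QPainleve.gaugeU hbar m d t x *
              QPainleve.deform m ζ (QPainleve.hB hbar m d bbar e) r t
                (fun y => QPainleve.gaugeUdag hbar m d t y * ψ y) x -
            Complex.I * (hbar : ℂ) * QPainleve.gaugeU hbar m d t x *
              QPainleve.pd r (fun τ => QPainleve.gaugeUdag hbar m d τ x) t * ψ x) ∧
    (QPainleve.QuantumFrobenius hbar m T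
        (QPainleve.deform m ζ (QPainleve.hB hbar m d bbar e)) ↔
      QPainleve.QuantumFrobenius hbar m T
        (QPainleve.deform m ζ (QPainleve.hA hbar m (QPainleve.cOf m d bbar e)))) := by
  have hh : hbar ≠ 0 := hhbar.ne'
  have hhC : (hbar : ℂ) ≠ 0 := Complex.ofReal_ne_zero.2 hh
  refine ⟨fun t ht r ψ hψ x hx => ?_, fun hB t ht r s ψ hψ x hx => ?_,
    fun hA t ht r s ψ hψ x hx => ?_⟩
  · have hU := QPainleve.gaugeU_mul_gaugeUdag hbar m d t x
    have hI : Complex.I * (hbar : ℂ) * (Complex.I / (hbar : ℂ)) = -1 := by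
      field_simp
      exact Complex.I_sq
    rw [QPainleve.deform_hA_eq hbar hm hPDE bbar e r ht ψ hx,
      QPainleve.deform_hB_gaugeUdag_mul hh ζ d bbar e r t hψ hx,
      QPainleve.pd_gaugeUdag hbar m (fun γ hγ =>
        QPainleve.differentiableAt_of_contDiffOn hT (hd γ hγ) ht) r x]
    generalize QPainleve.deformGeo hbar m ζ r t ψ x +
      ((QPainleve.deformScalar m ζ d bbar e r t x : ℝ) : ℂ) * ψ x = Q
    generalize ((QPainleve.phaseSum m (fun γ => QPainleve.pd r (d γ) t) x : ℝ) : ℂ) = W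
    linear_combination (-Q + Complex.I * (hbar : ℂ) * (Complex.I / (hbar : ℂ)) * W * ψ x) * hU +
      W * ψ x * hI
  · rw [QPainleve.frobenius_defect hh hm hT hζ hd he hPDE ht r s hψ hx,
      hB t ht r s _ ((QPainleve.smoothOn_gaugeUdag hbar m d t).mul hψ) x hx, mul_zero]
  · have hφ : QPainleve.SmoothOn m (fun y => QPainleve.gaugeU hbar m d t y * ψ y) :=
      (QPainleve.smoothOn_gaugeU hbar m d t).mul hψ
    -- Testing the A family on `Uψ` makes the B family act on `U†Uψ = ψ`.
    have h := QPainleve.frobenius_defect (bbar := bbar) (e := e) hh hm hT hζ hd he hPDE ht r s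
      hφ hx
    have hψ' : (fun y => QPainleve.gaugeUdag hbar m d t y *
        (QPainleve.gaugeU hbar m d t y * ψ y)) = ψ := by
      funext y
      rw [← mul_assoc, mul_comm (QPainleve.gaugeUdag hbar m d t y),
        QPainleve.gaugeU_mul_gaugeUdag, one_mul]
    rw [hA t ht r s _ hφ x hx, hψ'] at h
    exact (mul_eq_zero.1 h.symm).resolve_left (Complex.exp_ne_zero _)
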